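/- Notation. For $s\ge 0$ let $H^s(\mathbb R^n)$ be the space of $f\in L^2(\mathbb R^n;\mathbb C)$ with $\|f\|_{H^s(\mathbb R^n)}^2=(2\pi)^{-n}\int(1+|y|^2)^s|\hat f(y)|^2\,dy<\infty$, where $\hat f(y)=\int e^{-iy\cdot x}f(x)\,dx$. For an open set $U\subset\mathbb R^n$ let $H^s(U)$ be the space of restrictions to $U$ of elements of $H^s(\mathbb R^n)$, with norm $\|w\|_{H^s(U)}=\inf\{\|f\|_{H^s(\mathbb R^n)} : f|_U=w\}$. Let $\mathcal Q_k$ be the space of complex polynomials of degree at most $k$ on $\mathbb R^n$. A function is piecewise $C^1$ near a point if in a neighbourhood of it the function is continuous and at each point takes the value of one of finitely many fixed $C^1$ functions. An open set $\Omega\subset\mathbb R^n$ has piecewise $C^1$ boundary if near each boundary point, in suitable orthonormal coordinates, $\Omega$ is the set of points strictly above the graph of a piecewise $C^1$ function. Theorem. Let $n\ge1$, let $\Omega\subset\mathbb R^n$ be a bounded open set with piecewise $C^1$ boundary, and let $m\ge 0$ and $k\ge1$ be integers. Then there exist constants $A>0$, $B>0$, $C_l>0$ ($l=0,1,2,\dots$),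 $\kappa\in\mathbb Z_{\ge 0}$ and $\sigma>0$ such that for all sufficiently small $h>0$ there are sets $\omega_j\subset\mathbb R^n$, open balls $\omega_j^*\subset\mathbb R^n$ and functions $\phi_j:\mathbb R^n\to[0,\infty)$, indexed by the same set of indices $j$, for which the following Assumptions A–D hold with the local approximation spaces $\Psi_j=\mathcal Q_k$ (restricted to $\omega_j$). A. $h\le 1$. Each $\omega_j$ is convex with diameter $d_j\le h$. The ball $\omega_j^*$ has diameter at least $\sigma h$ and its closure is contained in $\omega_j$. Moreover, $\omega_j^*\subset\Omega$ if $\phi_j$ is not identically zero on $\Omega$. B. The $\omega_j$ are open and cover $\Omega$, and no $\kappa+1$ of them have a common point. Each $\phi_j$ is Lipschitz and of class $C^m$, $\operatorname{supp}\phi_j\subset\omega_j$, $\sum_j\phi_j=1$ on $\Omega$, and $\sup_{\Omega}|\partial^\alpha\phi_j|\le C_l/d_j^{\,l}$ for all multi-indices $\alpha$ with $l=|\alpha|\le m$. Finally, $\phi_j=1$ on $\omega_j^*$. C. $\Psi_j\subset H^m(\omega_j)$, $\Psi_j$ contains the restrictions to $\omega_j$ of all polynomials of degree at most $1$, and $\|w\|_{H^l(\omega_j)}\le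 A\|w\|_{H^l(\omega_j^*)}$ for all $j$, all $w\in\Psi_j$ and all real $0\le l\le m$. D. $\|w\|_{H^t(\omega_j)}\le B\,d_j^{\,s-t}\|w\|_{H^s(\omega_j)}$ for all $j$, all $w\in\Psi_j$ and all real $0\le s\le t\le m$. -/

import Mathlib

open MeasureTheory Topology
open scoped ENNReal FourierTransform RealInnerProductSpace

noncomputable section

namespace GFEM

/-- The Euclidean space `ℝⁿ`. -/
abbrev E (n : ℕ) : Type := EuclideanSpace ℝ (Fin n)

/-! ### Domains with piecewise `C¹` boundary -/

/-- `g` is piecewise `C¹` near `y₀`: on some open neighbourhood of `y₀` it is continuous and, at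
each point, takes the value of one of finitely many fixed `C¹` functions. -/
def PiecewiseC1At {F : Type*} [NormedAddCommGroup F] [NormedSpace ℝ F]
    (g : F → ℝ) (y₀ : F) : Prop :=
  ∃ V : Set F, IsOpen V ∧ y₀ ∈ V ∧ ContinuousOn g V ∧
    ∃ (N : ℕ) (p : Fin N → F → ℝ),
      (∀ i, ContDiffOn ℝ 1 (p i) V) ∧ ∀ y ∈ V, ∃ i, g y = p i y

/-- Near each of its boundary points, in suitable orthonormal coordinates, `Ω` is the set of points
lying strictly above the graph of a piecewise `C¹` function: here `e` is the direction of the last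
coordinate axis, and the remaining coordinates are those of the orthogonal projection of `x` onto
the hyperplane orthogonal to `e`. -/
def HasPiecewiseC1Boundary {n : ℕ} (Ω : Set (E n)) : Prop :=
  ∀ x₀ ∈ frontier Ω, ∃ (e : E n) (g : (Submodule.span ℝ {e})ᗮ → ℝ), ‖e‖ = 1 ∧
    PiecewiseC1At g ((Submodule.span ℝ {e})ᗮ.orthogonalProjectionOnto x₀) ∧
    ∀ᶠ x in 𝓝 x₀,
      (x ∈ Ω ↔ g ((Submodule.span ℝ {e})ᗮ.orthogonalProjectionOnto x) < ⟪e, x⟫)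

/-! ### Sobolev norms -/

/-- The norm of `H^s(ℝⁿ)` (with value `∞` when `f ∉ H^s(ℝⁿ)`). With
`f̂(y) = ∫ e^{-i y·x} f(x) dx = (𝓕 f)(y / 2π)`, the substitution `y = 2πξ` turns
`(2π)^{-n} ∫ (1 + |y|²)^s |f̂(y)|² dy` into the integral below. -/
def sobolevNormFull {n : ℕ} (s : ℝ) (f : Lp ℂ 2 (volume : Measure (E n))) : ℝ≥0∞ :=
  (∫⁻ ξ : E n, ENNReal.ofReal ((1 + (2 * Real.pi * ‖ξ‖) ^ 2) ^ s) *
    ‖(𝓕 f : Lp ℂ 2 (volume : Measure (E n))) ξ‖ₑ ^ 2) ^ (1 / 2 : ℝ)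

/-- The norm of `H^s(U)`, `s ≥ 0`, of (the restriction to `U` of) a function `w`: the infimum of the
`H^s(ℝⁿ)`-norms of the functions whose restriction to `U` is `w`. It is `∞` exactly when
`w ∉ H^s(U)`. -/
def sobolevNorm {n : ℕ} (s : ℝ) (U : Set (E n)) (w : E n → ℂ) : ℝ≥0∞ :=
  ⨅ (f : Lp ℂ 2 (volume : Measure (E n))) (_ : f =ᵐ[volume.restrict U] w), sobolevNormFull s f

/-! ### Partitions of unity and local approximation spaces -/

/-- The partial derivative `∂_{a 0} ⋯ ∂_{a (l-1)} f` of order `l` at `x`. -/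
def partialDeriv {n l : ℕ} (a : Fin l → Fin n) (f : E n → ℝ) (x : E n) : ℝ :=
  iteratedFDeriv ℝ l f x (fun i => EuclideanSpace.single (a i) (1 : ℝ))

/-- `φ` is a `(κ, C₀, …, C_m)` partition of unity on `Ω`, subordinated to the covering `ω`. -/
structure IsPartitionOfUnity {n : ℕ} {ι : Type*} (Ω : Set (E n)) (κ m : ℕ) (C : ℕ → ℝ)
    (ω : ι → Set (E n)) (φ : ι → E n → ℝ) : Prop where
  isOpen : ∀ j, IsOpen (ω j)
  covers : Ω ⊆ ⋃ j, ω j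
  overlap : ∀ J : Finset ι, J.card = κ + 1 → ¬ (⋂ j ∈ J, ω j).Nonempty
  nonneg : ∀ j x, 0 ≤ φ j x
  sum_eq_one : ∀ x ∈ Ω, ∑ᶠ j, φ j x = 1
  lipschitz : ∀ j, ∃ K, LipschitzWith K (φ j)
  support_subset : ∀ j, tsupport (φ j) ⊆ ω j
  smooth : ∀ j, ContDiff ℝ m (φ j)
  deriv_bound : ∀ j, ∀ l ≤ m, ∀ a : Fin l → Fin n, ∀ x ∈ Ω,
    |partialDeriv a (φ j) x| ≤ C l / Metric.diam (ω j) ^ l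

/-- Complex polynomial functions of (total) degree at most `k` on `ℝⁿ`. -/
def polySpace (n k : ℕ) : Submodule ℂ (E n → ℂ) where
  carrier := {w | ∃ p : MvPolynomial (Fin n) ℂ, p.totalDegree ≤ k ∧
    ∀ x, w x = MvPolynomial.eval (fun i => ((x i : ℝ) : ℂ)) p}
  zero_mem' := ⟨0, by simp, by simp⟩
  add_mem' := by
    rintro _ _ ⟨p, hp, hp'⟩ ⟨q, hq, hq'⟩
    exact ⟨p + q, (MvPolynomial.totalDegree_add p q).trans (max_le hp hq),
      fun x => by simp [hp', hq']⟩
  smul_mem' := by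
    rintro c _ ⟨p, hp, hp'⟩
    exact ⟨c • p, (MvPolynomial.totalDegree_smul_le c p).trans hp, fun x => by simp [hp']⟩

/-! ### Assumptions A–D

The ball `ω*_j` is `Metric.ball (c j) (r j)`, of diameter `2 * r j`. An element of the local
approximation space `Ψ j ⊆ H^m(ω_j)` is given by a function on `ℝⁿ`, of which only the restriction to
`ω j` matters. -/

structure AssumptionA {n : ℕ} {ι : Type*} (Ω : Set (E n)) (σ h : ℝ)
    (ω : ι → Set (E n)) (c : ι → E n) (r : ι → ℝ) (φ : ι → E n → ℝ) : Prop where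
  h_le_one : h ≤ 1
  convex : ∀ j, Convex ℝ (ω j)
  bounded : ∀ j, Bornology.IsBounded (ω j)
  diam_le : ∀ j, Metric.diam (ω j) ≤ h
  le_diam_ball : ∀ j, σ * h ≤ 2 * r j
  closure_ball_subset : ∀ j, closure (Metric.ball (c j) (r j)) ⊆ ω j
  ball_subset : ∀ j, (∃ x ∈ Ω, φ j x ≠ 0) → Metric.ball (c j) (r j) ⊆ Ω

structure AssumptionB {n : ℕ} {ι : Type*} (Ω : Set (E n)) (κ m : ℕ) (C : ℕ → ℝ)
    (ω : ι → Set (E n)) (c : ι → E n) (r : ι → ℝ) (φ : ι → E n → ℝ) : Prop where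
  partitionOfUnity : IsPartitionOfUnity Ω κ m C ω φ
  eq_one : ∀ j, ∀ x ∈ Metric.ball (c j) (r j), φ j x = 1

structure AssumptionC {n : ℕ} {ι : Type*} (A : ℝ) (m : ℕ)
    (ω : ι → Set (E n)) (c : ι → E n) (r : ι → ℝ) (Ψ : ι → Submodule ℂ (E n → ℂ)) : Prop where
  subset_sobolev : ∀ j, ∀ w ∈ Ψ j, sobolevNorm m (ω j) w < ∞
  contains_affine : ∀ j, ∀ p ∈ polySpace n 1, ∃ w ∈ Ψ j, Set.EqOn w p (ω j)
  norm_le : ∀ j, ∀ w ∈ Ψ j, ∀ l : ℝ, 0 ≤ l → l ≤ m →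
    sobolevNorm l (ω j) w ≤ ENNReal.ofReal A * sobolevNorm l (Metric.ball (c j) (r j)) w

/-- The inverse assumption. -/
def AssumptionD {n : ℕ} {ι : Type*} (B : ℝ) (m : ℕ)
    (ω : ι → Set (E n)) (Ψ : ι → Submodule ℂ (E n → ℂ)) : Prop :=
  ∀ j, ∀ w ∈ Ψ j, ∀ s t : ℝ, 0 ≤ s → s ≤ t → t ≤ m →
    sobolevNorm t (ω j) w ≤
      ENNReal.ofReal (B * Metric.diam (ω j) ^ (s - t)) * sobolevNorm s (ω j) w

end GFEM

end

namespace GFEM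

/-! All patches are balls of radius `h / 2` about finitely many points, and `ω*_j` is a concentric
ball of radius proportional to `h`. Two problems remain: choosing the centres and partition of unity
near the boundary, and proving C and D for all real orders with constants independent of `h` and of
the order.

Geometry: a piecewise `C¹` graph function is locally Lipschitz, so `Ω` has an interior corkscrew
property (`exists_corkscrew`): within distance `t` of each point of `Ω` lies the centre of a ball of
radius `c * t` inside `Ω`. Hence a maximal separated set of points that stay at distance of order
`h` from the complement of `Ω` still comes within `h / 8` of all of `Ω`. Packing bounds the overlap.
Normalized indicators of cells around these points form a partition of unity, each equal to `1` near
its own centre; mollifying at a smaller multiple of `h` makes it smooth and keeps these properties.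

Norms: a polynomial of degree at most `k` on a ray is recovered at `1` from its values at `k + 1`
nodes in `(0, a]`. So if `f` extends `w` from the small ball, a fixed linear combination of dilates
of `f` extends `w` from the large ball, and a dilation by a factor at most `1` raises every Sobolev
norm at most by a factor that depends neither on `s` nor on the radius. This gives C
(`sobolevNorm_ball_le`) without interpolation between integer orders. For D, extrapolation to `0`
yields a smooth compactly supported kernel that reproduces polynomials of degree at most `k`.
Averaging an extension `f` against this kernel at scale `ε` still gives `w` on a slightly smaller
ball, while the decay of the kernel's transform trades `t - s` derivatives for `ε ^ (s - t)`
(`exists_mollification`). C then restores the lost part of the ball. -/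

/-- Extrapolation of polynomials of degree at most `k` to the point `τ` from nodes in `(0, a]`. -/
theorem exists_extrapolation (k : ℕ) (τ a : ℝ) (ha : 0 < a) :
    ∃ (c : Fin (k + 1) → ℂ) (x : Fin (k + 1) → ℝ), (∀ i, 0 < x i ∧ x i ≤ a) ∧
      ∀ q : Polynomial ℂ, q.natDegree ≤ k → q.eval (τ : ℂ) = ∑ i, c i * q.eval ((x i : ℝ) : ℂ) := by
  set x : Fin (k + 1) → ℝ := fun i => a / (i + 1) with hx
  have hinj : Function.Injective fun i => ((x i : ℝ) : ℂ) := by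
    intro i j hij
    have h1 : a / ((i : ℝ) + 1) = a / ((j : ℝ) + 1) := Complex.ofReal_injective hij
    have h2 : ((i : ℝ) + 1) = (j : ℝ) + 1 := by
      have hi : (0 : ℝ) < (i : ℝ) + 1 := by positivity
      have hj : (0 : ℝ) < (j : ℝ) + 1 := by positivity
      field_simp at h1
      linarith
    have h3 : (i : ℕ) = j := by exact_mod_cast (add_right_cancel h2)
    exact Fin.ext h3
  refine ⟨fun i => (Lagrange.basis Finset.univ (fun i => ((x i : ℝ) : ℂ)) i).eval (τ : ℂ), x,
    fun i => ⟨by positivity, div_le_self ha.le (by linarith [(Nat.cast_nonneg (i : ℕ) : (0 : ℝ) ≤ _)])⟩,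
    fun q hq => ?_⟩
  have hdeg : q.degree < (Finset.univ : Finset (Fin (k + 1))).card := by
    rw [Finset.card_univ, Fintype.card_fin]
    exact (Polynomial.degree_le_of_natDegree_le hq).trans_lt (by exact_mod_cast Nat.lt_succ_self k)
  conv_lhs => rw [Lagrange.eq_interpolate hinj.injOn hdeg, Lagrange.interpolate_apply]
  simp only [Polynomial.eval_finsetSum, Polynomial.eval_mul, Polynomial.eval_C]
  exact Finset.sum_congr rfl fun i _ => mul_comm _ _

/-! ### Polynomials on lines and kernels reproducing them -/

theorem polySpace_line {n k : ℕ} {w : E n → ℂ} (hw : w ∈ polySpace n k) (u z : E n) :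
    ∃ q : Polynomial ℂ, q.natDegree ≤ k ∧ ∀ t : ℝ, w (u + t • z) = q.eval (t : ℂ) := by
  obtain ⟨p, hp, hpw⟩ := hw
  refine ⟨MvPolynomial.aeval (fun i => Polynomial.C ((u i : ℝ) : ℂ) +
    Polynomial.X * Polynomial.C ((z i : ℝ) : ℂ)) p, ?_, fun t => ?_⟩
  · rw [MvPolynomial.aeval_def, MvPolynomial.eval₂_eq']
    refine Polynomial.natDegree_sum_le_of_forall_le _ _ fun d hd => ?_
    refine (Polynomial.natDegree_C_mul_le _ _).trans ?_
    refine (Polynomial.natDegree_prod_le _ _).trans ?_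
    refine le_trans (Finset.sum_le_sum (g := fun i => d i) fun i _ => ?_) (le_trans ?_ hp)
    · refine (Polynomial.natDegree_pow_le).trans ?_
      refine (Nat.mul_le_mul_left _ ?_).trans (mul_one _).le
      compute_degree
    · have := MvPolynomial.le_totalDegree hd
      rwa [Finsupp.sum_fintype _ _ (fun _ => rfl)] at this
  · rw [hpw, ← Polynomial.coe_aeval_eq_eval]
    rw [← MvPolynomial.coe_aeval_eq_eval, ← AlgHom.comp_apply]
    rw [← AlgHom.restrictScalars_apply ℂ]
    congr 1
    rw [MvPolynomial.comp_aeval]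
    congr 1
    ext i
    simp
    ring

theorem polySpace_continuous {n k : ℕ} {w : E n → ℂ} (hw : w ∈ polySpace n k) : Continuous w := by
  obtain ⟨p, -, hpw⟩ := hw
  rw [funext hpw]
  simp only [MvPolynomial.eval_eq']
  fun_prop

theorem polySpace_mono {n k l : ℕ} (h : k ≤ l) : polySpace n k ≤ polySpace n l := by
  rintro w ⟨p, hp, hpw⟩
  exact ⟨p, hp.trans h, hpw⟩

/-- Kernels reproducing all polynomials of degree at most `k`. -/
def IsReproducing {n : ℕ} (k : ℕ) (H : E n → ℂ) : Prop :=
  ∀ w ∈ polySpace n k, ∀ (u : E n) (ε : ℝ), ∫ z, H z * w (u + ε • z) = w u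

/-- Combine dilates of one normalized bump with the coefficients that extrapolate from nodes in `(0,
1]` to `0`: after rescaling, the integrand becomes the bump times the extrapolated value `w u`. -/
theorem exists_reproducing (n k : ℕ) : ∃ H : E n → ℂ, ContDiff ℝ (⊤ : ℕ∞) H ∧
    (∀ z, 1 ≤ ‖z‖ → H z = 0) ∧ IsReproducing k H := by
  obtain ⟨c, x, hx, hq⟩ := exists_extrapolation k 0 1 one_pos
  let b : ContDiffBump (0 : E n) := ⟨1 / 2, 1, by norm_num, by norm_num⟩
  let g : E n → ℝ := b.normed volume
  have hg : ContDiff ℝ (⊤ : ℕ∞) g := b.contDiff_normed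
  have hg0 : ∀ z, 1 ≤ ‖z‖ → g z = 0 := by
    intro z hz
    have : z ∉ Function.support g := by
      rw [b.support_normed_eq]
      simpa [b] using hz
    simpa using this
  refine ⟨fun z => ∑ i, c i * ((((x i)⁻¹ ^ n * g ((x i)⁻¹ • z) : ℝ)) : ℂ), ?_, ?_, ?_⟩
  · refine ContDiff.sum fun i _ => contDiff_const.mul ?_
    refine Complex.ofRealCLM.contDiff.comp ?_
    exact contDiff_const.mul (hg.comp (contDiff_const_smul _))
  · intro z hz
    refine Finset.sum_eq_zero fun i _ => ?_
    rw [hg0]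
    · simp
    · rw [norm_smul, norm_inv, Real.norm_of_nonneg (hx i).1.le]
      have h1 : 1 ≤ (x i)⁻¹ := (one_le_inv₀ (hx i).1).2 (hx i).2
      nlinarith
  · intro w hw u ε
    have hwc := polySpace_continuous hw
    have hcs : HasCompactSupport g := b.hasCompactSupport_normed
    have hint : ∀ t : ℝ, Integrable fun z => (g z : ℂ) * w (u + t • z) := by
      intro t
      refine Continuous.integrable_of_hasCompactSupport
        ((Complex.continuous_ofReal.comp hg.continuous).mul (by fun_prop)) ?_
      exact HasCompactSupport.mul_right (hcs.comp_left Complex.ofReal_zero)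
    have hscale : ∀ i, ∫ z, (((x i)⁻¹ ^ n * g ((x i)⁻¹ • z) : ℝ) : ℂ) * w (u + ε • z) =
        ∫ z, (g z : ℂ) * w (u + (x i) • ε • z) := by
      intro i
      have := MeasureTheory.Measure.integral_comp_smul_of_nonneg volume
        (fun z => (g z : ℂ) * w (u + (x i) • ε • z)) (x i)⁻¹ (hR := (inv_pos.2 (hx i).1).le)
      simp only [finrank_euclideanSpace_fin, inv_pow, inv_inv] at this
      have hxn : (x i) ^ n ≠ 0 := (pow_pos (hx i).1 n).ne'
      rw [← inv_smul_eq_iff₀ hxn, ← integral_smul] at this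
      rw [← this]
      congr 1
      ext z
      have e : x i • ε • (x i)⁻¹ • z = ε • z := by
        rw [smul_comm ε, smul_inv_smul₀ (hx i).1.ne']
      rw [e]
      simp only [Complex.real_smul]
      push_cast
      ring
    have hI : ∀ i, Integrable fun z => (((x i)⁻¹ ^ n * g ((x i)⁻¹ • z) : ℝ) : ℂ) * w (u + ε • z) := by
      intro i
      refine Continuous.integrable_of_hasCompactSupport
        ((Complex.continuous_ofReal.comp (continuous_const.mul
          (hg.continuous.comp (continuous_const_smul _)))).mul (by fun_prop)) ?_
      refine HasCompactSupport.mul_right ?_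
      refine HasCompactSupport.comp_left (g := Complex.ofReal) ?_ Complex.ofReal_zero
      exact HasCompactSupport.mul_left (hcs.comp_smul (inv_pos.2 (hx i).1).ne')
    simp only [Finset.sum_mul, mul_assoc]
    rw [integral_finsetSum]
    swap
    · intro i _
      exact (hI i).const_mul _
    have hint' : ∀ i, Integrable fun z => (g z : ℂ) * w (u + (x i) • ε • z) := by
      intro i
      simpa only [smul_smul] using hint (x i * ε)
    simp_rw [integral_const_mul, hscale, ← integral_const_mul]
    rw [← integral_finsetSum _ fun i _ => (hint' i).const_mul _]
    have : ∀ z, ∑ i, c i * ((g z : ℂ) * w (u + (x i) • ε • z)) = (g z : ℂ) * w u := by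
      intro z
      obtain ⟨q, hqd, hqe⟩ := polySpace_line hw u (ε • z)
      have h0 := hq q hqd
      rw [← hqe 0, zero_smul, add_zero] at h0
      rw [h0, Finset.mul_sum]
      refine Finset.sum_congr rfl fun i _ => ?_
      rw [hqe]
      ring
    simp_rw [this]
    rw [integral_mul_const, integral_complex_ofReal, b.integral_normed]
    simp

/-! ### The Fourier transform on `L²` by duality -/

theorem integral_fourierInv_mul_fourier {n : ℕ} (f : Lp ℂ 2 (volume : Measure (E n)))
    (θ : SchwartzMap (E n) ℂ) :
    ∫ ξ, (𝓕⁻ θ : SchwartzMap (E n) ℂ) ξ * (𝓕 f : Lp ℂ 2 (volume : Measure (E n))) ξ =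
      ∫ x, θ x * f x := by
  have h := congrArg (fun T : TemperedDistribution (E n) ℂ => T (𝓕⁻ θ))
    (Lp.fourier_toTemperedDistribution_eq f)
  simp only [TemperedDistribution.fourier_apply, FourierTransform.fourier_fourierInv_eq,
    Lp.toTemperedDistribution_apply, smul_eq_mul] at h
  exact h.symm

/-- An `L²` function is determined by its pairings with Schwartz functions, so a candidate for `𝓕 F`
need only be checked by duality. -/
theorem fourier_eq_of_forall_integral {n : ℕ} (F G : Lp ℂ 2 (volume : Measure (E n)))
    (h : ∀ ψ : SchwartzMap (E n) ℂ,
      ∫ ξ, (𝓕⁻ ψ : SchwartzMap (E n) ℂ) ξ * G ξ = ∫ x, ψ x * F x) : 𝓕 F = G := by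
  have hinj : Function.Injective
      (Lp.toTemperedDistributionCLM ℂ (volume : Measure (E n)) 2) :=
    LinearMap.ker_eq_bot.1 Lp.ker_toTemperedDistributionCLM_eq_bot
  apply hinj
  simp only [Lp.toTemperedDistributionCLM_apply]
  rw [← Lp.fourier_toTemperedDistribution_eq]
  ext ψ
  have := h (𝓕 ψ)
  rw [FourierTransform.fourierInv_fourier_eq] at this
  simp only [TemperedDistribution.fourier_apply, Lp.toTemperedDistribution_apply, smul_eq_mul]
  exact this.symm

/-! ### Dilations -/

theorem map_affine {n : ℕ} {a : ℝ} (ha : 0 < a) (v : E n) :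
    Measure.map (fun x : E n => a • x + v) volume = ENNReal.ofReal (a ^ n)⁻¹ • volume := by
  have h1 : Measure.map (fun x : E n => a • x) volume = ENNReal.ofReal (a ^ n)⁻¹ • volume := by
    rw [Measure.map_addHaar_smul volume ha.ne', finrank_euclideanSpace_fin,
      abs_of_pos (inv_pos.2 (pow_pos ha n))]
  have h2 : (fun x : E n => a • x + v) = (fun x => x + v) ∘ fun x => a • x := rfl
  rw [h2, ← Measure.map_map (by fun_prop) (by fun_prop), h1, Measure.map_smul,
    map_add_right_eq_self]

theorem measurableEmbedding_affine {n : ℕ} {a : ℝ} (ha : 0 < a) (v : E n) :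
    MeasurableEmbedding (fun x : E n => a • x + v) :=
  (((Homeomorph.smulOfNeZero a ha.ne').trans (Homeomorph.addRight v)).measurableEmbedding)

theorem integral_comp_affine {n : ℕ} {G : Type*} [NormedAddCommGroup G] [NormedSpace ℝ G]
    {a : ℝ} (ha : 0 < a) (v : E n) (F : E n → G) :
    ∫ x, F (a • x + v) = ((a ^ n)⁻¹ : ℝ) • ∫ x, F x := by
  rw [← (measurableEmbedding_affine ha v).integral_map, map_affine ha, integral_smul_measure,
    ENNReal.toReal_ofReal (inv_pos.2 (pow_pos ha n)).le]

theorem lintegral_comp_affine {n : ℕ} {a : ℝ} (ha : 0 < a) (v : E n) (F : E n → ℝ≥0∞) :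
    ∫⁻ x, F (a • x + v) = ENNReal.ofReal (a ^ n)⁻¹ * ∫⁻ x, F x := by
  rw [← (measurableEmbedding_affine ha v).lintegral_map, map_affine ha, lintegral_smul_measure,
    smul_eq_mul]

theorem quasiMeasurePreserving_affine {n : ℕ} {a : ℝ} (ha : 0 < a) (v : E n) :
    Measure.QuasiMeasurePreserving (fun x : E n => a • x + v) volume volume :=
  ⟨by fun_prop, by rw [map_affine ha]; exact Measure.smul_absolutelyContinuous⟩

theorem memLp_comp_affine {n : ℕ} {a : ℝ} (ha : 0 < a) (v : E n) {f : E n → ℂ}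
    (hf : MemLp f 2 (volume : Measure (E n))) :
    MemLp (fun x => f (a • x + v)) 2 (volume : Measure (E n)) := by
  refine (memLp_map_measure_iff (f := fun x : E n => a • x + v) (g := f) ?_ (by fun_prop)).1 ?_
  · rw [map_affine ha]
    exact hf.1.smul_measure _
  · rw [map_affine ha]
    exact hf.smul_measure ENNReal.ofReal_ne_top

theorem fourierInv_affine {n : ℕ} {a : ℝ} (ha : 0 < a) (v : E n) (ψ : E n → ℂ) (η : E n) :
    (𝓕⁻ (fun u => (((a ^ n)⁻¹ : ℝ) : ℂ) * ψ (a⁻¹ • u - a⁻¹ • v))) η =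
      Complex.exp (↑(2 * Real.pi * ⟪v, η⟫) * Complex.I) * (𝓕⁻ ψ) (a • η) := by
  simp only [Real.fourierInv_eq', smul_eq_mul]
  rw [← integral_const_mul]
  have := integral_comp_affine ha v (fun u =>
    Complex.exp (↑(2 * Real.pi * ⟪u, η⟫) * Complex.I) * ψ (a⁻¹ • u - a⁻¹ • v))
  rw [Complex.real_smul, ← integral_const_mul] at this
  simp only [smul_add, inv_smul_smul₀ ha.ne', add_sub_cancel_right] at this
  calc _ = ∫ u, (((a ^ n)⁻¹ : ℝ) : ℂ) * (Complex.exp (↑(2 * Real.pi * ⟪u, η⟫) * Complex.I) *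
        ψ (a⁻¹ • u - a⁻¹ • v)) := by congr 1; ext u; ring
    _ = _ := by
      rw [← this]
      congr 1
      ext x
      rw [← mul_assoc, ← Complex.exp_add, inner_add_left, real_inner_smul_left,
        real_inner_smul_right]
      congr 2
      push_cast
      ring

/-- The transform of `f (a • x + v)` is `a⁻ⁿ` times a phase times `𝓕 f` at `ξ / a`. As `a ≤ 1`,
passing from `ξ` to `ξ / a` only increases the Sobolev weight, so one constant serves every `s ≥ 0`.
-/
theorem exists_dilation {n : ℕ} (f : Lp ℂ 2 (volume : Measure (E n))) {a : ℝ} (ha : 0 < a)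
    (ha1 : a ≤ 1) (v : E n) :
    ∃ g : Lp ℂ 2 (volume : Measure (E n)), (∀ᵐ x, g x = f (a • x + v)) ∧
      ∀ s : ℝ, 0 ≤ s → sobolevNormFull s g ≤ ENNReal.ofReal ((a ^ n)⁻¹) * sobolevNormFull s f := by
  have hai : 0 < a⁻¹ := inv_pos.2 ha
  have hg := memLp_comp_affine ha v (Lp.memLp f)
  set G₀ : E n → ℂ := fun ξ =>
    ((((a ^ n)⁻¹ : ℝ) : ℂ) * Complex.exp (↑(2 * Real.pi * ⟪v, a⁻¹ • ξ⟫) * Complex.I)) *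
      (𝓕 f : Lp ℂ 2 (volume : Measure (E n))) (a⁻¹ • ξ + 0) with hG₀
  have hnorm : ∀ ξ, ‖((((a ^ n)⁻¹ : ℝ) : ℂ) *
      Complex.exp (↑(2 * Real.pi * ⟪v, a⁻¹ • ξ⟫) * Complex.I))‖ = (a ^ n)⁻¹ := by
    intro ξ
    rw [norm_mul, Complex.norm_exp_ofReal_mul_I, mul_one, Complex.norm_real,
      Real.norm_of_nonneg (by positivity)]
  have hG : MemLp G₀ 2 (volume : Measure (E n)) := by
    refine MemLp.of_le_mul (c := (a ^ n)⁻¹)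
      (memLp_comp_affine hai 0 (Lp.memLp (𝓕 f : Lp ℂ 2 (volume : Measure (E n))))) ?_ ?_
    · refine AEStronglyMeasurable.mul ?_
        (memLp_comp_affine hai 0 (Lp.memLp (𝓕 f : Lp ℂ 2 (volume : Measure (E n))))).1
      exact Continuous.aestronglyMeasurable (by fun_prop)
    · refine Filter.Eventually.of_forall fun ξ => ?_
      rw [hG₀, norm_mul, hnorm]
  refine ⟨hg.toLp _, hg.coeFn_toLp, fun s hs => ?_⟩
  have hF : 𝓕 (hg.toLp _) = hG.toLp _ := by
    refine fourier_eq_of_forall_integral _ _ fun ψ => ?_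
    set θ : SchwartzMap (E n) ℂ := (((a ^ n)⁻¹ : ℝ) : ℂ) •
      (SchwartzMap.compSubConstCLM ℂ v (SchwartzMap.compCLMOfContinuousLinearEquiv ℂ
        (ContinuousLinearEquiv.smulLeft (M₁ := E n) (R₁ := ℝ) (Units.mk0 a⁻¹ hai.ne')) ψ)) with hθ
    have hθ' : (θ : E n → ℂ) = fun u => (((a ^ n)⁻¹ : ℝ) : ℂ) * ψ (a⁻¹ • u - a⁻¹ • v) := by
      ext u
      simp [hθ, smul_sub, Units.smul_def]
    have h1 := integral_fourierInv_mul_fourier f θ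
    have h2 : ∀ η, (𝓕⁻ θ : SchwartzMap (E n) ℂ) η =
        Complex.exp (↑(2 * Real.pi * ⟪v, η⟫) * Complex.I) *
          (𝓕⁻ ψ : SchwartzMap (E n) ℂ) (a • η) := by
      intro η
      rw [SchwartzMap.fourierInv_coe, SchwartzMap.fourierInv_coe, hθ', fourierInv_affine ha]
    simp only [h2, hθ'] at h1
    have h3 := integral_comp_affine ha v
      (fun u => (((a ^ n)⁻¹ : ℝ) : ℂ) * ψ (a⁻¹ • u - a⁻¹ • v) * f u)
    have h4 := integral_comp_affine hai 0 (fun η =>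
      Complex.exp (↑(2 * Real.pi * ⟪v, η⟫) * Complex.I) *
          (𝓕⁻ ψ : SchwartzMap (E n) ℂ) (a • η) *
            (𝓕 f : Lp ℂ 2 (volume : Measure (E n))) η)
    have hc : (((a ^ n)⁻¹ : ℝ) : ℂ) ≠ 0 := by
      exact_mod_cast (inv_pos.2 (pow_pos ha n)).ne'
    have e1 : ∫ ξ, (𝓕⁻ ψ : SchwartzMap (E n) ℂ) ξ * (hG.toLp _ : Lp ℂ 2 volume) ξ =
        (((a ^ n)⁻¹ : ℝ) : ℂ) * ∫ ξ, (fun η =>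
          Complex.exp (↑(2 * Real.pi * ⟪v, η⟫) * Complex.I) *
          (𝓕⁻ ψ : SchwartzMap (E n) ℂ) (a • η) *
            (𝓕 f : Lp ℂ 2 (volume : Measure (E n))) η) (a⁻¹ • ξ + 0) := by
      rw [← integral_const_mul]
      refine integral_congr_ae ?_
      filter_upwards [hG.coeFn_toLp] with ξ hξ
      rw [hξ, hG₀]
      simp only [add_zero, smul_inv_smul₀ ha.ne']
      ring
    have e2 : ∫ x, ψ x * (hg.toLp _ : Lp ℂ 2 volume) x = ∫ x, ψ x * f (a • x + v) := by
      refine integral_congr_ae ?_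
      filter_upwards [hg.coeFn_toLp] with ξ hξ
      rw [hξ]
    simp only [smul_add, inv_smul_smul₀ ha.ne', add_sub_cancel_right, mul_assoc] at h3
    rw [integral_const_mul, Complex.real_smul] at h3
    have h3' := mul_left_cancel₀ hc h3
    rw [e1, h4, e2, h3', Complex.real_smul, h1, ← mul_assoc]
    have : (((a ^ n)⁻¹ : ℝ) : ℂ) * (((a⁻¹ ^ n)⁻¹ : ℝ) : ℂ) = 1 := by
      rw [← Complex.ofReal_mul, inv_pow, inv_inv, inv_mul_cancel₀ (pow_pos ha n).ne',
        Complex.ofReal_one]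
    rw [this, one_mul]
    simp only [mul_assoc]
  unfold sobolevNormFull
  rw [hF]
  have hpn : (0 : ℝ) < a ^ n := pow_pos ha n
  set I : E n → ℝ≥0∞ := fun ξ => ENNReal.ofReal ((1 + (2 * Real.pi * ‖ξ‖) ^ 2) ^ s) *
    ‖(𝓕 f : Lp ℂ 2 (volume : Measure (E n))) ξ‖ₑ ^ 2 with hI
  have key : ∫⁻ ξ, ENNReal.ofReal ((1 + (2 * Real.pi * ‖ξ‖) ^ 2) ^ s) *
      ‖(hG.toLp _ : Lp ℂ 2 (volume : Measure (E n))) ξ‖ₑ ^ 2 ≤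
      ENNReal.ofReal (a ^ n)⁻¹ ^ 2 * ∫⁻ ξ, I ξ := by
    calc _ ≤ ∫⁻ ξ, ENNReal.ofReal (a ^ n)⁻¹ ^ 2 * I (a⁻¹ • ξ + 0) := by
          refine lintegral_mono_ae ?_
          filter_upwards [hG.coeFn_toLp] with ξ hξ
          rw [hξ, hG₀, hI]
          simp only [add_zero]
          rw [enorm_mul, ← ofReal_norm ((((a ^ n)⁻¹ : ℝ) : ℂ) * _), hnorm,
            mul_pow (ENNReal.ofReal _), ← mul_assoc, ← mul_assoc]
          refine mul_le_mul_left ?_ _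
          rw [mul_comm]
          refine mul_le_mul_right ?_ _
          refine ENNReal.ofReal_le_ofReal (Real.rpow_le_rpow (by positivity) ?_ hs)
          have : ‖ξ‖ ≤ ‖a⁻¹ • ξ‖ := by
            rw [norm_smul, norm_inv, Real.norm_of_nonneg ha.le]
            exact le_mul_of_one_le_left (norm_nonneg _) ((one_le_inv₀ ha).2 ha1)
          gcongr
      _ = ENNReal.ofReal (a ^ n)⁻¹ ^ 2 * (ENNReal.ofReal (a⁻¹ ^ n)⁻¹ * ∫⁻ ξ, I ξ) := by
          rw [lintegral_const_mul' _ _ (by finiteness), lintegral_comp_affine hai]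
      _ ≤ ENNReal.ofReal (a ^ n)⁻¹ ^ 2 * (1 * ∫⁻ ξ, I ξ) := by
          gcongr
          rw [ENNReal.ofReal_le_one, inv_pow, inv_inv]
          exact pow_le_one₀ ha.le ha1
      _ = _ := by rw [one_mul]
  calc _ ≤ (ENNReal.ofReal (a ^ n)⁻¹ ^ 2 * ∫⁻ ξ, I ξ) ^ (1 / 2 : ℝ) :=
        ENNReal.rpow_le_rpow key (by norm_num)
    _ = _ := by
      rw [ENNReal.mul_rpow_of_nonneg _ _ (by norm_num), ← ENNReal.rpow_natCast,
        ← ENNReal.rpow_mul]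
      norm_num

/-! ### Mollification -/

open scoped Convolution in
theorem fourierInv_convolution {n : ℕ} (f g : SchwartzMap (E n) ℂ) (ξ : E n) :
    (𝓕⁻ (SchwartzMap.convolution (ContinuousLinearMap.mul ℂ ℂ) f g) : SchwartzMap (E n) ℂ) ξ =
      (𝓕⁻ f : SchwartzMap (E n) ℂ) ξ * (𝓕⁻ g : SchwartzMap (E n) ℂ) ξ := by
  have h : ∀ (θ : SchwartzMap (E n) ℂ), (𝓕⁻ θ : SchwartzMap (E n) ℂ) ξ =
      (𝓕 θ : SchwartzMap (E n) ℂ) (-ξ) := by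
    intro θ
    rw [SchwartzMap.fourierInv_coe, SchwartzMap.fourier_coe, Real.fourierInv_eq_fourier_neg]
  rw [h, h, h, SchwartzMap.fourier_convolution]
  simp [SchwartzMap.pairing, mul_comm]

/-- The rescaled kernel `ε⁻ⁿ H(x / ε)`. -/
noncomputable def rescale {n : ℕ} (ε : ℝ) (H : E n → ℂ) : E n → ℂ :=
  fun u => (((ε ^ n)⁻¹ : ℝ) : ℂ) * H (ε⁻¹ • u - ε⁻¹ • (0 : E n))

theorem rescale_contDiff {n : ℕ} (ε : ℝ) {H : E n → ℂ} (hH : ContDiff ℝ (⊤ : ℕ∞) H) :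
    ContDiff ℝ (⊤ : ℕ∞) (rescale ε H) :=
  contDiff_const.mul (hH.comp (by fun_prop))

theorem rescale_eq_zero {n : ℕ} {ε : ℝ} (hε : 0 < ε) {H : E n → ℂ}
    (hH0 : ∀ z, 1 ≤ ‖z‖ → H z = 0) {z : E n} (hz : ε ≤ ‖z‖) : rescale ε H z = 0 := by
  unfold rescale
  rw [hH0, mul_zero]
  rw [smul_zero, sub_zero, norm_smul, norm_inv, Real.norm_of_nonneg hε.le, inv_mul_eq_div]
  exact (one_le_div hε).2 hz

theorem hasCompactSupport_of_norm {n : ℕ} {H : E n → ℂ} {ε : ℝ}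
    (hH0 : ∀ z, ε ≤ ‖z‖ → H z = 0) : HasCompactSupport H :=
  HasCompactSupport.intro (isCompact_closedBall (0 : E n) ε) fun z hz =>
    hH0 z (by simpa using (not_le.1 (by simpa using hz)).le)

theorem IsReproducing.integral_rescale {n k : ℕ} {H : E n → ℂ} (hH : IsReproducing k H)
    {ε : ℝ} (hε : 0 < ε) {w : E n → ℂ} (hw : w ∈ polySpace n k) (u : E n) :
    ∫ z, rescale ε H z * w (u + z) = w u := by
  have := integral_comp_affine hε 0 (fun z => rescale ε H z * w (u + z))
  simp only [rescale, add_zero, smul_zero, sub_zero, inv_smul_smul₀ hε.ne', mul_assoc] at this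
  rw [integral_const_mul, hH w hw u ε, Complex.real_smul] at this
  have hc : (((ε ^ n)⁻¹ : ℝ) : ℂ) ≠ 0 := by exact_mod_cast (inv_pos.2 (pow_pos hε n)).ne'
  rw [mul_left_cancel₀ hc this]
  simp only [rescale, smul_zero, sub_zero, mul_assoc]

open scoped Convolution in
-- By Fubini the kernel moves from the test function onto `w`, which it reproduces.
theorem IsReproducing.integral_convolution_mul {n k : ℕ} {H : E n → ℂ} (hH : IsReproducing k H)
    (hHs : ContDiff ℝ (⊤ : ℕ∞) H) (hH0 : ∀ z, 1 ≤ ‖z‖ → H z = 0)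
    {ε ρ : ℝ} (hε : 0 < ε) {y : E n} {w : E n → ℂ} (hw : w ∈ polySpace n k) {ψ : E n → ℂ}
    (hψ : Continuous ψ) (hψ0 : ∀ x, ρ ≤ dist x y → ψ x = 0) :
    ∫ x, (rescale ε H ⋆[ContinuousLinearMap.mul ℂ ℂ] ψ) x * w x = ∫ x, ψ x * w x := by
  have hwc := polySpace_continuous hw
  have hHc : Continuous (rescale ε H) := (rescale_contDiff ε hHs).continuous
  simp only [convolution_eq_swap, ContinuousLinearMap.mul_apply', ← integral_mul_const]
  rw [integral_integral_swap]
  · congr 1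
    ext u
    rw [← hH.integral_rescale hε hw u, ← integral_const_mul,
      ← integral_add_left_eq_self _ u]
    congr 1
    ext z
    rw [add_sub_cancel_left]
    ring
  · refine Continuous.integrable_of_hasCompactSupport (by fun_prop) ?_
    refine HasCompactSupport.intro ((isCompact_closedBall y (ρ + ε)).prod
      (isCompact_closedBall y ρ)) ?_
    rintro ⟨x, u⟩ hxu
    simp only [Function.uncurry_apply_pair]
    by_cases hu : ρ ≤ dist u y
    · simp [hψ0 u hu]
    · have : ε ≤ ‖x - u‖ := by
        by_contra hcon
        apply hxu
        push Not at hu hcon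
        refine ⟨?_, by simpa using hu.le⟩
        have := dist_triangle x u y
        rw [dist_eq_norm x u] at this
        simp only [Metric.mem_closedBall]
        linarith
      simp [rescale_eq_zero hε hH0 this]

open scoped Convolution in
-- `F` is the average `∫ H_ε(z) f(u + z) dz`, with `H_ε` the kernel at scale `ε`; it sees only
-- values of `f` within `ε` of `u`, where `f` agrees with `w`. On the Fourier side this is
-- multiplication by `N (ε • ξ)` with `N` Schwartz, and decay of order `m` pays for the gain `t - s
-- ≤ m`.
theorem exists_mollification (n k m : ℕ) : ∃ B : ℝ, 0 < B ∧
    ∀ (y : E n) (ρ ε : ℝ), 0 < ε → ε ≤ 1 → ∀ w ∈ polySpace n k,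
      ∀ f : Lp ℂ 2 (volume : Measure (E n)),
      f =ᵐ[volume.restrict (Metric.ball y (ρ + ε))] w →
      ∃ F : Lp ℂ 2 (volume : Measure (E n)), F =ᵐ[volume.restrict (Metric.ball y ρ)] w ∧
        ∀ s t : ℝ, s ≤ t → t ≤ s + m →
          sobolevNormFull t F ≤ ENNReal.ofReal (B * ε ^ (s - t)) * sobolevNormFull s f := by
  obtain ⟨H, hHs, hH0, hH⟩ := exists_reproducing n k
  let HS : SchwartzMap (E n) ℂ := (hasCompactSupport_of_norm hH0).toSchwartzMap hHs
  set N : SchwartzMap (E n) ℂ := 𝓕⁻ HS with hN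
  obtain ⟨D, hD0, hD⟩ : ∃ D : ℝ, 0 < D ∧ ∀ ζ, (1 + ‖ζ‖) ^ m * ‖N ζ‖ ≤ D := by
    obtain ⟨D, hD⟩ : ∃ D : ℝ, ∀ ζ, (1 + ‖ζ‖) ^ m * ‖N ζ‖ ≤ D := by
      refine ⟨2 ^ m * ((Finset.Iic (m, 0)).sup fun j => SchwartzMap.seminorm ℂ j.1 j.2) N,
        fun ζ => ?_⟩
      have := SchwartzMap.one_add_le_sup_seminorm_apply (𝕜 := ℂ) (m := (m, 0)) (k := m) (n := 0)
        le_rfl le_rfl N ζ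
      rwa [norm_iteratedFDeriv_zero] at this
    exact ⟨max D 1, by positivity, fun ζ => (hD ζ).trans (le_max_left _ _)⟩
  refine ⟨(2 * Real.pi) ^ m * D, by positivity, fun y ρ ε hε hε1 w hw f hf => ?_⟩
  have hwc := polySpace_continuous hw
  have hND : ∀ ζ, ‖N ζ‖ ≤ D := fun ζ => le_trans
    (le_mul_of_one_le_left (norm_nonneg _) (one_le_pow₀ (by linarith [norm_nonneg ζ]))) (hD ζ)
  have hNc : Continuous N := N.continuous
  have hG : MemLp (fun ξ => N (ε • ξ) * (𝓕 f : Lp ℂ 2 (volume : Measure (E n))) ξ) 2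
      (volume : Measure (E n)) := by
    refine MemLp.of_le_mul (c := D) (Lp.memLp (𝓕 f : Lp ℂ 2 (volume : Measure (E n)))) ?_ ?_
    · exact (Continuous.aestronglyMeasurable (by fun_prop)).mul (Lp.memLp _).1
    · refine Filter.Eventually.of_forall fun ξ => ?_
      rw [norm_mul]
      exact mul_le_mul_of_nonneg_right (hND _) (norm_nonneg _)
  set F : Lp ℂ 2 (volume : Measure (E n)) := 𝓕⁻ (hG.toLp _) with hF
  have hFF : 𝓕 F = hG.toLp _ := by rw [hF, FourierTransform.fourier_fourierInv_eq]
  refine ⟨F, ?_, fun s t hst hts => ?_⟩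
  · let HE : SchwartzMap (E n) ℂ := (hasCompactSupport_of_norm
      (fun z => rescale_eq_zero hε hH0 (z := z))).toSchwartzMap (rescale_contDiff ε hHs)
    have hHE : ∀ ξ, (𝓕⁻ HE : SchwartzMap (E n) ℂ) ξ = N (ε • ξ) := by
      intro ξ
      rw [hN, SchwartzMap.fourierInv_coe, SchwartzMap.fourierInv_coe]
      have := fourierInv_affine hε 0 H ξ
      simp only [inner_zero_left, mul_zero, Complex.ofReal_zero, zero_mul, Complex.exp_zero,
        one_mul] at this
      exact this
    have hloc : LocallyIntegrable (fun x => F x - w x) (volume : Measure (E n)) :=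
      ((Lp.memLp F).locallyIntegrable (by norm_num)).sub hwc.locallyIntegrable
    have := Metric.isOpen_ball.ae_eq_zero_of_integral_contDiff_smul_eq_zero (U := Metric.ball y ρ)
      (hloc.locallyIntegrableOn _) ?_
    · rw [Filter.EventuallyEq, ae_restrict_iff' Metric.isOpen_ball.measurableSet]
      filter_upwards [this] with x hx hxU
      exact sub_eq_zero.1 (hx hxU)
    · intro g hg hgc hgU
      have hψc : HasCompactSupport fun x => (g x : ℂ) := hgc.comp_left Complex.ofReal_zero
      have hψs : ContDiff ℝ (⊤ : ℕ∞) fun x => (g x : ℂ) := Complex.ofRealCLM.contDiff.comp hg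
      let ψ : SchwartzMap (E n) ℂ := hψc.toSchwartzMap hψs
      have hψ0 : ∀ x, ρ ≤ dist x y → ψ x = 0 := by
        intro x hx
        have : x ∉ tsupport g := fun h => by
          have := hgU h
          rw [Metric.mem_ball] at this
          linarith
        change (g x : ℂ) = 0
        rw [image_eq_zero_of_notMem_tsupport this, Complex.ofReal_zero]
      have hψint : Integrable fun x => ψ x * w x :=
        (ψ.continuous.mul hwc).integrable_of_hasCompactSupport hψc.mul_right
      have hψF : Integrable fun x => ψ x * F x := by
        have := ((Lp.memLp F).locallyIntegrable
          (by norm_num)).integrable_smul_left_of_hasCompactSupport hg.continuous hgc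
        refine this.congr (Filter.Eventually.of_forall fun x => ?_)
        exact Complex.real_smul
      have e : ∀ x, g x • (F x - w x) = ψ x * F x - ψ x * w x := by
        intro x
        rw [Complex.real_smul, mul_sub]
        rfl
      simp_rw [e]
      rw [integral_sub hψF hψint, sub_eq_zero, ← integral_fourierInv_mul_fourier, hFF]
      have h1 : ∫ ξ, (𝓕⁻ ψ : SchwartzMap (E n) ℂ) ξ * (hG.toLp _ : Lp ℂ 2 volume) ξ =
          ∫ ξ, (𝓕⁻ (SchwartzMap.convolution (ContinuousLinearMap.mul ℂ ℂ) HE ψ) :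
            SchwartzMap (E n) ℂ) ξ * (𝓕 f : Lp ℂ 2 (volume : Measure (E n))) ξ := by
        refine integral_congr_ae ?_
        filter_upwards [hG.coeFn_toLp] with ξ hξ
        rw [hξ, fourierInv_convolution, hHE]
        ring
      rw [h1, integral_fourierInv_mul_fourier,
        ← hH.integral_convolution_mul hHs hH0 hε hw ψ.continuous hψ0]
      refine integral_congr_ae ?_
      rw [Filter.EventuallyEq, ae_restrict_iff' Metric.isOpen_ball.measurableSet] at hf
      filter_upwards [hf] with x hx
      rw [SchwartzMap.convolution_apply]
      by_cases hxb : x ∈ Metric.ball y (ρ + ε)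
      · rw [hx hxb]
        rfl
      · have : (rescale ε H ⋆[ContinuousLinearMap.mul ℂ ℂ] ψ) x = 0 := by
          rw [convolution_def]
          refine integral_eq_zero_of_ae (Filter.Eventually.of_forall fun z => ?_)
          simp only [ContinuousLinearMap.mul_apply', Pi.zero_apply]
          by_cases hz : ε ≤ ‖z‖
          · rw [rescale_eq_zero hε hH0 hz, zero_mul]
          · rw [hψ0, mul_zero]
            rw [Metric.mem_ball, not_lt] at hxb
            have h2 := dist_triangle x (x - z) y
            rw [dist_eq_norm x (x - z), sub_sub_cancel] at h2
            linarith
        change (rescale ε H ⋆[ContinuousLinearMap.mul ℂ ℂ] ψ) x * _ =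
          (rescale ε H ⋆[ContinuousLinearMap.mul ℂ ℂ] ψ) x * _
        rw [this, zero_mul, zero_mul]
  · set K : ℝ := (2 * Real.pi) ^ m * D * ε ^ (s - t) with hK
    have hK0 : 0 ≤ K := by positivity
    have hpt : ∀ ξ : E n, (1 + (2 * Real.pi * ‖ξ‖) ^ 2) ^ t * ‖N (ε • ξ)‖ ^ 2 ≤
        K ^ 2 * (1 + (2 * Real.pi * ‖ξ‖) ^ 2) ^ s := by
      intro ξ
      set X : ℝ := 1 + (2 * Real.pi * ‖ξ‖) ^ 2 with hX
      set a : ℝ := ‖ε • ξ‖ with ha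
      have ha' : a = ε * ‖ξ‖ := by rw [ha, norm_smul, Real.norm_of_nonneg hε.le]
      have ha0 : 0 ≤ a := norm_nonneg _
      have hX0 : 0 < X := by positivity
      have hpi : 1 ≤ 2 * Real.pi := by linarith [Real.pi_gt_three]
      -- Since `ε ≤ 1`, the weight is at most quadratic in `1 + ‖ε • ξ‖` with a factor `ε⁻¹ ^ 2`;
      -- its power `t - s` is then absorbed by the decay bound `D`.
      have hXb : X ≤ (ε⁻¹ * (2 * Real.pi * (1 + a))) ^ 2 := by
        have h1 : ε * 1 ≤ 1 := by linarith
        have h2 : ‖ξ‖ = ε⁻¹ * a := by rw [ha']; field_simp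
        have h3 : 1 ≤ ε⁻¹ := (one_le_inv₀ hε).2 hε1
        rw [hX, h2]
        have h4 : (ε⁻¹ * (2 * Real.pi * (1 + a))) ^ 2 = (ε⁻¹ * (2 * Real.pi)) ^ 2 +
          2 * a * (ε⁻¹ * (2 * Real.pi)) ^ 2 + (2 * Real.pi * (ε⁻¹ * a)) ^ 2 := by ring
        have h5 : 1 ≤ (ε⁻¹ * (2 * Real.pi)) ^ 2 :=
          one_le_pow₀ (one_le_mul_of_one_le_of_one_le h3 hpi)
        rw [h4]
        have h6 : 0 ≤ 2 * a * (ε⁻¹ * (2 * Real.pi)) ^ 2 := by positivity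
        linarith
      have hb1 : 1 ≤ 2 * Real.pi * (1 + a) :=
        one_le_mul_of_one_le_of_one_le hpi (by linarith)
      have hXts : X ^ (t - s) ≤ (ε ^ (s - t) * (2 * Real.pi * (1 + a)) ^ m) ^ 2 := by
        calc X ^ (t - s) ≤ ((ε⁻¹ * (2 * Real.pi * (1 + a))) ^ 2) ^ (t - s) :=
              Real.rpow_le_rpow hX0.le hXb (by linarith)
          _ = (ε ^ (s - t) * (2 * Real.pi * (1 + a)) ^ (t - s)) ^ 2 := by
              rw [← Real.rpow_natCast, ← Real.rpow_mul (by positivity),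
                mul_comm ((2 : ℕ) : ℝ), Real.rpow_mul (by positivity), Real.rpow_natCast,
                Real.mul_rpow (by positivity) (by positivity), Real.inv_rpow hε.le,
                ← Real.rpow_neg hε.le, neg_sub]
          _ ≤ _ := by
              gcongr
              rw [← Real.rpow_natCast]
              exact Real.rpow_le_rpow_of_exponent_le hb1 (by linarith)
      have hXt : X ^ t = X ^ (t - s) * X ^ s := by
        rw [← Real.rpow_add hX0, sub_add_cancel]
      calc X ^ t * ‖N (ε • ξ)‖ ^ 2 = X ^ (t - s) * ‖N (ε • ξ)‖ ^ 2 * X ^ s := by rw [hXt]; ring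
        _ ≤ (ε ^ (s - t) * (2 * Real.pi * (1 + a)) ^ m) ^ 2 * ‖N (ε • ξ)‖ ^ 2 * X ^ s := by
            gcongr
        _ = (ε ^ (s - t) * (2 * Real.pi) ^ m * ((1 + a) ^ m * ‖N (ε • ξ)‖)) ^ 2 * X ^ s := by
            rw [mul_pow (2 * Real.pi)]; ring
        _ ≤ (ε ^ (s - t) * (2 * Real.pi) ^ m * D) ^ 2 * X ^ s := by
            gcongr
            exact hD _
        _ = _ := by rw [hK]; ring
    unfold sobolevNormFull
    rw [hFF]
    have key : ∫⁻ ξ, ENNReal.ofReal ((1 + (2 * Real.pi * ‖ξ‖) ^ 2) ^ t) *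
        ‖(hG.toLp _ : Lp ℂ 2 (volume : Measure (E n))) ξ‖ₑ ^ 2 ≤
        ENNReal.ofReal K ^ 2 * ∫⁻ ξ, ENNReal.ofReal ((1 + (2 * Real.pi * ‖ξ‖) ^ 2) ^ s) *
          ‖(𝓕 f : Lp ℂ 2 (volume : Measure (E n))) ξ‖ₑ ^ 2 := by
      rw [← lintegral_const_mul' _ _ (by finiteness)]
      refine lintegral_mono_ae ?_
      filter_upwards [hG.coeFn_toLp] with ξ hξ
      rw [hξ, enorm_mul, mul_pow ‖N (ε • ξ)‖ₑ, ← mul_assoc, ← mul_assoc]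
      refine mul_le_mul_left ?_ _
      rw [← ofReal_norm, ← ENNReal.ofReal_pow (norm_nonneg _), ← ENNReal.ofReal_pow hK0,
        ← ENNReal.ofReal_mul (by positivity), ← ENNReal.ofReal_mul (by positivity)]
      exact ENNReal.ofReal_le_ofReal (hpt ξ)
    calc _ ≤ (ENNReal.ofReal K ^ 2 * _) ^ (1 / 2 : ℝ) := ENNReal.rpow_le_rpow key (by norm_num)
      _ = _ := by
        rw [ENNReal.mul_rpow_of_nonneg _ _ (by norm_num), ← ENNReal.rpow_natCast,
          ← ENNReal.rpow_mul]
        norm_num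

/-! ### Sobolev norms of polynomials on balls -/

/-- The measure whose `L²` norm of `𝓕 f` is the Sobolev norm of `f`. -/
noncomputable def sobolevMeasure (n : ℕ) (s : ℝ) : Measure (E n) :=
  volume.withDensity fun ξ => ENNReal.ofReal ((1 + (2 * Real.pi * ‖ξ‖) ^ 2) ^ s)

theorem sobolevMeasure_absolutelyContinuous (n : ℕ) (s : ℝ) :
    sobolevMeasure n s ≪ (volume : Measure (E n)) :=
  withDensity_absolutelyContinuous _ _

theorem sobolevNormFull_eq_eLpNorm {n : ℕ} (s : ℝ) (f : Lp ℂ 2 (volume : Measure (E n))) :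
    sobolevNormFull s f = eLpNorm (𝓕 f : Lp ℂ 2 (volume : Measure (E n))) 2 (sobolevMeasure n s) := by
  rw [eLpNorm_eq_lintegral_rpow_enorm_toReal (by norm_num) (by norm_num), sobolevMeasure,
    lintegral_withDensity_eq_lintegral_mul₀]
  · simp [sobolevNormFull]
  · exact Measurable.aemeasurable (by fun_prop)
  · exact ((Lp.memLp _).1.aemeasurable.enorm.pow_const _)

theorem sobolevNormFull_add_le {n : ℕ} (s : ℝ) (f g : Lp ℂ 2 (volume : Measure (E n))) :
    sobolevNormFull s (f + g) ≤ sobolevNormFull s f + sobolevNormFull s g := by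
  simp only [sobolevNormFull_eq_eLpNorm, FourierTransform.fourier_add]
  have hac := sobolevMeasure_absolutelyContinuous n s
  rw [eLpNorm_congr_ae (hac.ae_eq (Lp.coeFn_add _ _))]
  exact eLpNorm_add_le ((Lp.memLp _).1.mono_ac hac) ((Lp.memLp _).1.mono_ac hac) (by norm_num)

theorem sobolevNormFull_smul {n : ℕ} (s : ℝ) (c : ℂ) (f : Lp ℂ 2 (volume : Measure (E n))) :
    sobolevNormFull s (c • f) = ‖c‖ₑ * sobolevNormFull s f := by
  simp only [sobolevNormFull_eq_eLpNorm, FourierTransform.fourier_smul]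
  have hac := sobolevMeasure_absolutelyContinuous n s
  rw [eLpNorm_congr_ae (hac.ae_eq (Lp.coeFn_smul _ _)), eLpNorm_const_smul]

theorem sobolevNormFull_zero_right {n : ℕ} (s : ℝ) :
    sobolevNormFull s (0 : Lp ℂ 2 (volume : Measure (E n))) = 0 := by
  have := sobolevNormFull_smul s 0 (0 : Lp ℂ 2 (volume : Measure (E n)))
  simpa using this

theorem sobolevNormFull_sum_smul_le {n : ℕ} {ι : Type*} (J : Finset ι) (s : ℝ) (c : ι → ℂ)
    (g : ι → Lp ℂ 2 (volume : Measure (E n))) :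
    sobolevNormFull s (∑ i ∈ J, c i • g i) ≤ ∑ i ∈ J, ‖c i‖ₑ * sobolevNormFull s (g i) := by
  classical
  induction J using Finset.induction_on with
  | empty => simp [sobolevNormFull_zero_right]
  | insert i J hi ih =>
    rw [Finset.sum_insert hi, Finset.sum_insert hi]
    refine (sobolevNormFull_add_le _ _ _).trans ?_
    rw [sobolevNormFull_smul]
    gcongr

theorem le_mul_sobolevNorm {n : ℕ} {s : ℝ} {U : Set (E n)} {w : E n → ℂ} {A : ℝ} (hA : 0 < A)
    {x : ℝ≥0∞} (h : ∀ f : Lp ℂ 2 (volume : Measure (E n)), f =ᵐ[volume.restrict U] w →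
      x ≤ ENNReal.ofReal A * sobolevNormFull s f) :
    x ≤ ENNReal.ofReal A * sobolevNorm s U w := by
  have h0 : ENNReal.ofReal A ≠ 0 := (ENNReal.ofReal_pos.2 hA).ne'
  unfold sobolevNorm
  rw [ENNReal.mul_iInf_of_ne h0 ENNReal.ofReal_ne_top]
  refine le_iInf fun f => ?_
  rw [ENNReal.mul_iInf_of_ne h0 ENNReal.ofReal_ne_top]
  exact le_iInf fun hf => h f hf

theorem sobolevNorm_le {n : ℕ} {s : ℝ} {U : Set (E n)} {w : E n → ℂ}
    {f : Lp ℂ 2 (volume : Measure (E n))} (hf : f =ᵐ[volume.restrict U] w) :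
    sobolevNorm s U w ≤ sobolevNormFull s f :=
  iInf₂_le f hf

/-- On each ray from `y`, extrapolation to `1` writes `w z` through the values `w (y + x i • (z -
y))`, whose arguments lie in the small ball. The same combination of dilates of an extension `f`
therefore extends `w` from the large ball. -/
theorem sobolevNorm_ball_le (n k : ℕ) {a : ℝ} (ha : 0 < a) (ha1 : a ≤ 1) :
    ∃ A : ℝ, 0 < A ∧ ∀ (y : E n) (R : ℝ), 0 < R → ∀ w ∈ polySpace n k, ∀ s : ℝ, 0 ≤ s →
      sobolevNorm s (Metric.ball y R) w ≤
        ENNReal.ofReal A * sobolevNorm s (Metric.ball y (a * R)) w := by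
  obtain ⟨c, x, hx, hq⟩ := exists_extrapolation k 1 a ha
  refine ⟨1 + ∑ i, ‖c i‖ * (x i ^ n)⁻¹, ?_, fun y R hR w hw s hs => ?_⟩
  · have : ∀ i, 0 < x i := fun i => (hx i).1
    have : 0 ≤ ∑ i, ‖c i‖ * (x i ^ n)⁻¹ := Finset.sum_nonneg fun i _ => by
      have := this i
      positivity
    linarith
  · refine le_mul_sobolevNorm (lt_of_lt_of_le one_pos (le_add_of_nonneg_right ?_)) fun f hf => ?_
    · exact Finset.sum_nonneg fun i _ => by
        have := (hx i).1
        positivity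
    choose g hg hgs using fun i => exists_dilation f (hx i).1 ((hx i).2.trans ha1) (y - x i • y)
    have hF : (∑ i, c i • g i : Lp ℂ 2 (volume : Measure (E n))) =ᵐ[volume.restrict
        (Metric.ball y R)] w := by
      rw [Filter.EventuallyEq, ae_restrict_iff' Metric.isOpen_ball.measurableSet] at hf ⊢
      have h1 : ∀ᵐ z, ∀ i, (c i • g i : Lp ℂ 2 (volume : Measure (E n))) z = c i * g i z :=
        ae_all_iff.2 fun i => Lp.coeFn_smul _ _
      have h2 := ae_all_iff.2 hg
      have h3 : ∀ᵐ z : E n, ∀ i, x i • z + (y - x i • y) ∈ Metric.ball y (a * R) →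
          f (x i • z + (y - x i • y)) = w (x i • z + (y - x i • y)) :=
        ae_all_iff.2 fun i => (quasiMeasurePreserving_affine (hx i).1 _).ae hf
      filter_upwards [Lp.coeFn_finsetSum Finset.univ (fun i => c i • g i), h1, h2, h3]
        with z h0 h1 h2 h3 hz
      rw [h0, Finset.sum_apply]
      obtain ⟨q, hqd, hqe⟩ := polySpace_line hw y (z - y)
      have h4 := hq q hqd
      rw [← hqe, one_smul, add_sub_cancel] at h4
      rw [h4]
      refine Finset.sum_congr rfl fun i _ => ?_
      have e : x i • z + (y - x i • y) = y + x i • (z - y) := by rw [smul_sub]; abel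
      rw [h1, h2, h3, e, hqe]
      rw [e, Metric.mem_ball, dist_eq_norm, add_sub_cancel_left, norm_smul,
        Real.norm_of_nonneg (hx i).1.le]
      rw [Metric.mem_ball, dist_eq_norm] at hz
      calc x i * ‖z - y‖ ≤ a * ‖z - y‖ := by gcongr; exact (hx i).2
        _ < a * R := by gcongr
    refine (sobolevNorm_le hF).trans ((sobolevNormFull_sum_smul_le _ _ _ _).trans ?_)
    calc ∑ i, ‖c i‖ₑ * sobolevNormFull s (g i)
        ≤ ∑ i, ENNReal.ofReal (‖c i‖ * (x i ^ n)⁻¹) * sobolevNormFull s f := by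
          refine Finset.sum_le_sum fun i _ => ?_
          rw [ENNReal.ofReal_mul (norm_nonneg _), ofReal_norm, mul_assoc]
          exact mul_le_mul_right (hgs i s hs) _
      _ ≤ _ := by
          rw [← Finset.sum_mul, ← ENNReal.ofReal_sum_of_nonneg]
          · refine mul_le_mul_left (ENNReal.ofReal_le_ofReal ?_) _
            linarith
          · intro i _
            have := (hx i).1
            positivity

/-- Mollifying at scale `h / 4` shrinks the ball from `h / 2` to `h / 4`, and `sobolevNorm_ball_le`
with ratio `1 / 2` returns to the original. The factor `4 ^ m` comes from `(h / 4) ^ (s - t)`. -/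
theorem sobolevNorm_inverse_ball (n k m : ℕ) :
    ∃ B : ℝ, 0 < B ∧ ∀ (y : E n) (h : ℝ), 0 < h → h ≤ 1 → ∀ w ∈ polySpace n k,
      ∀ s t : ℝ, 0 ≤ s → s ≤ t → t ≤ m →
        sobolevNorm t (Metric.ball y (h / 2)) w ≤
          ENNReal.ofReal (B * h ^ (s - t)) * sobolevNorm s (Metric.ball y (h / 2)) w := by
  obtain ⟨A, hA, hAle⟩ := sobolevNorm_ball_le n k (a := 1 / 2) (by norm_num) (by norm_num)
  obtain ⟨B, hB, hBle⟩ := exists_mollification n k m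
  refine ⟨A * (B * 4 ^ m), by positivity, fun y h hh hh1 w hw s t hs hst htm => ?_⟩
  refine le_mul_sobolevNorm (by positivity) fun f hf => ?_
  have e : h / 2 = h / 4 + h / 4 := by ring
  rw [e] at hf
  obtain ⟨F, hF, hFn⟩ := hBle y (h / 4) (h / 4) (by positivity) (by linarith) w hw f hf
  have e2 : 1 / 2 * (h / 2) = h / 4 := by ring
  calc sobolevNorm t (Metric.ball y (h / 2)) w
      ≤ ENNReal.ofReal A * sobolevNorm t (Metric.ball y (h / 4)) w := by
        rw [← e2]
        exact hAle y _ (by positivity) w hw t (hs.trans hst)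
    _ ≤ ENNReal.ofReal A * (ENNReal.ofReal (B * (h / 4) ^ (s - t)) * sobolevNormFull s f) := by
        refine mul_le_mul_right ((sobolevNorm_le hF).trans (hFn s t hst ?_)) _
        linarith
    _ = ENNReal.ofReal (A * (B * (h / 4) ^ (s - t))) * sobolevNormFull s f := by
        rw [ENNReal.ofReal_mul hA.le, mul_assoc]
    _ ≤ _ := by
        refine mul_le_mul_left (ENNReal.ofReal_le_ofReal ?_) _
        rw [mul_assoc A, mul_assoc B]
        refine mul_le_mul_of_nonneg_left (mul_le_mul_of_nonneg_left ?_ hB.le) hA.le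
        rw [div_eq_mul_inv, mul_comm h, Real.mul_rpow (by norm_num) hh.le]
        refine mul_le_mul_of_nonneg_right ?_ (by positivity)
        rw [Real.inv_rpow (by norm_num), ← Real.rpow_neg (by norm_num), ← Real.rpow_natCast]
        exact Real.rpow_le_rpow_of_exponent_le (by norm_num) (by linarith)

theorem sobolevNormFull_zero_lt_top {n : ℕ} (f : Lp ℂ 2 (volume : Measure (E n))) :
    sobolevNormFull 0 f < ∞ := by
  rw [sobolevNormFull_eq_eLpNorm]
  have : sobolevMeasure n 0 = volume := by simp [sobolevMeasure, ← Pi.one_def, withDensity_one]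
  rw [this]
  exact (Lp.memLp (𝓕 f : Lp ℂ 2 (volume : Measure (E n)))).2

/-- The inverse estimate with `s = 0` reduces this to extending `w` by zero in `L²`. -/
theorem sobolevNorm_ball_lt_top {n k m : ℕ} {w : E n → ℂ} (hw : w ∈ polySpace n k) (y : E n)
    {h : ℝ} (hh : 0 < h) (hh1 : h ≤ 1) : sobolevNorm m (Metric.ball y (h / 2)) w < ∞ := by
  obtain ⟨B, -, hB⟩ := sobolevNorm_inverse_ball n k m
  refine (hB y h hh hh1 w hw 0 m le_rfl (by positivity) le_rfl).trans_lt
    (ENNReal.mul_lt_top ENNReal.ofReal_lt_top ?_)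
  have hwc := polySpace_continuous hw
  have hmem : MemLp ((Metric.ball y (h / 2)).indicator w) 2 (volume : Measure (E n)) := by
    rw [memLp_indicator_iff_restrict Metric.isOpen_ball.measurableSet]
    obtain ⟨C, hC⟩ := (isCompact_closedBall y (h / 2)).exists_bound_of_continuousOn hwc.continuousOn
    have : IsFiniteMeasure (volume.restrict (Metric.ball y (h / 2))) :=
      ⟨by rw [Measure.restrict_apply_univ]; exact measure_ball_lt_top⟩
    refine MemLp.of_bound hwc.aestronglyMeasurable C ?_
    refine (ae_restrict_iff' Metric.isOpen_ball.measurableSet).2 (Filter.Eventually.of_forall ?_)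
    exact fun x hx => hC x (Metric.ball_subset_closedBall hx)
  refine (sobolevNorm_le (f := hmem.toLp _) ?_).trans_lt (sobolevNormFull_zero_lt_top _)
  rw [Filter.EventuallyEq, ae_restrict_iff' Metric.isOpen_ball.measurableSet]
  filter_upwards [hmem.coeFn_toLp] with x hx hxb
  rw [hx, Set.indicator_of_mem hxb]

/-! ### The interior corkscrew condition -/

/-- Just to the right of `x`, continuity and finiteness allow only those selections `p i` that
already agree with `u` at `x`, so slopes of `u` there are slopes of some `p i`. The mean value
inequality for right slopes concludes. -/
theorem sub_le_of_continuousOn_selection {N : ℕ} {u : ℝ → ℝ} {p : Fin N → ℝ → ℝ} {L : ℝ}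
    (hu : ContinuousOn u (Set.Icc 0 1)) (hp : ∀ i, ∀ x ∈ Set.Icc (0 : ℝ) 1, ∀ y ∈ Set.Icc (0 : ℝ) 1,
      |p i x - p i y| ≤ L * |x - y|) (hsel : ∀ x ∈ Set.Icc (0 : ℝ) 1, ∃ i, u x = p i x) :
    u 1 - u 0 ≤ L := by
  have hpc : ∀ i, ContinuousOn (p i) (Set.Icc 0 1) := by
    intro i
    refine (LipschitzOnWith.of_dist_le_mul (K := L.toNNReal) fun x hx y hy => ?_).continuousOn
    rw [Real.dist_eq, Real.dist_eq]
    exact (hp i x hx y hy).trans (by gcongr; exact Real.le_coe_toNNReal L)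
  have hmain := image_le_of_liminf_slope_right_le_deriv_boundary (f := u) (a := 0) (b := 1) hu
    (B := fun x => u 0 + L * x) (B' := fun _ => L) (by simp) (by fun_prop)
    (fun x _ => by
      simpa using (((hasDerivAt_id x).const_mul L).const_add (u 0)).hasDerivWithinAt) ?_
    (Set.right_mem_Icc.2 zero_le_one)
  · simp only [mul_one] at hmain
    linarith
  intro x hx r hr
  refine Filter.Eventually.frequently ?_
  have hxI : x ∈ Set.Icc (0 : ℝ) 1 := Set.Ico_subset_Icc_self hx
  have hIcc : Set.Icc (0 : ℝ) 1 ∈ 𝓝[>] x :=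
    Filter.mem_of_superset (Ioo_mem_nhdsGT hx.2) fun z hz => ⟨hx.1.trans hz.1.le, hz.2.le⟩
  have hle : 𝓝[>] x ≤ 𝓝[Set.Icc 0 1] x :=
    nhdsWithin_le_iff.2 hIcc
  have hall : ∀ᶠ z in 𝓝[>] x, ∀ i, u x ≠ p i x → u z ≠ p i z := by
    rw [Filter.eventually_all]
    intro i
    by_cases h : u x = p i x
    · simp [h]
    · have h1 : Filter.Tendsto (fun z => u z - p i z) (𝓝[>] x) (𝓝 (u x - p i x)) :=
        (((hu x hxI).sub (hpc i x hxI)).tendsto).mono_left hle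
      filter_upwards [h1.eventually_ne (sub_ne_zero.2 h)] with z hz _
      exact sub_ne_zero.1 hz
  filter_upwards [hall, hIcc, self_mem_nhdsWithin] with z hz hzI hzx
  obtain ⟨i, hi⟩ := hsel z hzI
  have hxi : u x = p i x := by
    by_contra hne
    exact hz i hne hi
  have hzx' : 0 < z - x := sub_pos.2 hzx
  rw [slope_def_field, hi, hxi]
  refine lt_of_le_of_lt ?_ hr
  rw [div_le_iff₀ hzx']
  refine (le_abs_self _).trans ((hp i z hzI x hxI).trans ?_)
  rw [abs_of_pos hzx']

theorem PiecewiseC1At.exists_lipschitz {F : Type*} [NormedAddCommGroup F] [NormedSpace ℝ F]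
    {g : F → ℝ} {y₀ : F} (hg : PiecewiseC1At g y₀) :
    ∃ L : ℝ, 0 ≤ L ∧ ∃ δ > 0, ∀ y ∈ Metric.ball y₀ δ, ∀ z ∈ Metric.ball y₀ δ,
      g z - g y ≤ L * ‖z - y‖ := by
  obtain ⟨V, hV, hyV, hgc, N, p, hp, hsel⟩ := hg
  have hlip : ∀ i, ∃ K : NNReal, ∃ t ∈ 𝓝 y₀, LipschitzOnWith K (p i) t := fun i =>
    ((hp i).contDiffAt (hV.mem_nhds hyV)).exists_lipschitzOnWith
  choose K t ht hK using hlip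
  obtain ⟨δ, hδ, hball⟩ := Metric.mem_nhds_iff.1
    (Filter.inter_mem (hV.mem_nhds hyV) (Filter.iInter_mem.2 ht))
  refine ⟨∑ i, (K i : ℝ), Finset.sum_nonneg fun i _ => (K i).2, δ, hδ, fun y hy z hz => ?_⟩
  have hseg : ∀ τ ∈ Set.Icc (0 : ℝ) 1, y + τ • (z - y) ∈ Metric.ball y₀ δ := fun τ hτ =>
    (convex_ball y₀ δ).add_smul_sub_mem hy hz hτ
  have := sub_le_of_continuousOn_selection (u := fun τ => g (y + τ • (z - y)))
    (p := fun i τ => p i (y + τ • (z - y))) (L := (∑ i, (K i : ℝ)) * ‖z - y‖) ?_ ?_ ?_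
  · simpa using this
  · refine hgc.comp (by fun_prop) fun τ hτ => (hball (hseg τ hτ)).1
  · intro i a ha b hb
    have h1 := (hK i).dist_le_mul _ (Set.mem_iInter.1 (hball (hseg a ha)).2 i) _
      (Set.mem_iInter.1 (hball (hseg b hb)).2 i)
    rw [Real.dist_eq, dist_eq_norm, add_sub_add_left_eq_sub, ← sub_smul, norm_smul,
      Real.norm_eq_abs] at h1
    refine h1.trans ?_
    have h2 : (K i : ℝ) ≤ ∑ i, (K i : ℝ) :=
      Finset.single_le_sum (fun i _ => (K i).2) (Finset.mem_univ i)
    calc (K i : ℝ) * (|a - b| * ‖z - y‖) ≤ (∑ i, (K i : ℝ)) * (|a - b| * ‖z - y‖) := by gcongr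
      _ = _ := by ring
  · exact fun τ hτ => hsel _ (hball (hseg τ hτ)).1

/-- Moving up by `t` along `e` gains height `t`, while inside a ball of radius `ρ = t / (2 * (1 +
L))` height and graph together vary by at most `(1 + L) * ρ = t / 2`. -/
theorem exists_corkscrew_of_mem_frontier {n : ℕ} {Ω : Set (E n)} (hΩ : HasPiecewiseC1Boundary Ω)
    {x₀ : E n} (hx₀ : x₀ ∈ frontier Ω) :
    ∃ U ∈ 𝓝 x₀, ∃ c t₀ : ℝ, 0 < c ∧ 0 < t₀ ∧ ∀ x ∈ Ω ∩ U, ∀ t : ℝ, 0 < t → t ≤ t₀ →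
      ∃ y, dist y x ≤ t ∧ Metric.ball y (c * t) ⊆ Ω := by
  obtain ⟨e, g, he, hg, hΩg⟩ := hΩ x₀ hx₀
  obtain ⟨L, hL, δ, hδ, hlip⟩ := hg.exists_lipschitz
  set P := (Submodule.span ℝ {e})ᗮ.orthogonalProjectionOnto with hP
  have hPe : P e = 0 := by
    rw [hP, Submodule.orthogonalProjectionOnto_eq_zero_iff]
    exact Submodule.le_orthogonal_orthogonal _ (Submodule.mem_span_singleton_self e)
  have hPn : ∀ v, ‖P v‖ ≤ ‖v‖ := fun v => by
    simpa using (Submodule.norm_orthogonalProjectionOnto_apply_le _ v)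
  have hPc : ∀ᶠ x in 𝓝 x₀, P x ∈ Metric.ball (P x₀) δ :=
    P.continuous.continuousAt.eventually (Metric.ball_mem_nhds _ hδ)
  obtain ⟨r, hr, hball⟩ := Metric.mem_nhds_iff.1 (Filter.inter_mem hΩg hPc)
  refine ⟨Metric.ball x₀ (r / 2), Metric.ball_mem_nhds _ (by positivity), 1 / (2 * (1 + L)), r / 4,
    by positivity, by positivity, ?_⟩
  rintro x ⟨hxΩ, hxU⟩ t ht htr
  have hc1 : 1 / (2 * (1 + L)) * t ≤ t / 2 := by
    rw [div_mul_eq_mul_div, one_mul]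
    exact div_le_div_of_nonneg_left ht.le (by norm_num) (by linarith)
  have hcL : (1 + L) * (1 / (2 * (1 + L)) * t) = t / 2 := by
    have : 1 + L ≠ 0 := by positivity
    field_simp
  set ρ := 1 / (2 * (1 + L)) * t with hρ
  refine ⟨x + t • e, by simp [norm_smul, he, abs_of_pos ht], fun z hz => ?_⟩
  rw [Metric.mem_ball, dist_eq_norm] at hz
  rw [Metric.mem_ball] at hxU
  have hxb : x ∈ Metric.ball x₀ r := by rw [Metric.mem_ball]; linarith
  have hzb : z ∈ Metric.ball x₀ r := by
    rw [Metric.mem_ball]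
    have h1 := dist_triangle4 z (x + t • e) x x₀
    have h2 : dist (x + t • e) x = t := by simp [norm_smul, he, abs_of_pos ht]
    rw [dist_eq_norm z (x + t • e)] at h1
    linarith
  have hgx := ((hball hxb).1).1 hxΩ
  refine ((hball hzb).1).2 ?_
  have h3 := hlip _ (hball hxb).2 _ (hball hzb).2
  have h4 : P z - P x = P (z - (x + t • e)) := by
    rw [map_sub, map_add, map_smul, hPe, smul_zero, add_zero]
  have h5 : ‖P z - P x‖ ≤ ρ := by rw [h4]; exact (hPn _).trans hz.le
  have h6 : ⟪e, z⟫ = ⟪e, x⟫ + t + ⟪e, z - (x + t • e)⟫ := by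
    rw [inner_sub_right, inner_add_right, real_inner_smul_right, real_inner_self_eq_norm_sq, he]
    ring
  have h7 : |⟪e, z - (x + t • e)⟫| ≤ ρ := by
    refine (abs_real_inner_le_norm _ _).trans ?_
    rw [he, one_mul]
    exact hz.le
  have h8 : L * ‖P z - P x‖ ≤ L * ρ := by gcongr
  have h9 := (abs_le.1 h7).1
  nlinarith

theorem exists_corkscrew {n : ℕ} {Ω : Set (E n)} (hΩo : IsOpen Ω) (hΩb : Bornology.IsBounded Ω)
    (hΩ : HasPiecewiseC1Boundary Ω) :
    ∃ c t₀ : ℝ, 0 < c ∧ 0 < t₀ ∧ ∀ x ∈ Ω, ∀ t : ℝ, 0 < t → t ≤ t₀ →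
      ∃ y, dist y x ≤ t ∧ Metric.ball y (c * t) ⊆ Ω := by
  have := hΩb.isCompact_closure.induction_on (p := fun S => ∃ c t₀ : ℝ, 0 < c ∧ 0 < t₀ ∧
    ∀ x ∈ Ω ∩ S, ∀ t : ℝ, 0 < t → t ≤ t₀ →
      ∃ y, dist y x ≤ t ∧ Metric.ball y (c * t) ⊆ Ω) ?_ ?_ ?_ ?_
  · obtain ⟨c, t₀, hc, ht₀, h⟩ := this
    exact ⟨c, t₀, hc, ht₀, fun x hx => h x ⟨hx, subset_closure hx⟩⟩
  · exact ⟨1, 1, one_pos, one_pos, by simp⟩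
  · rintro S T hST ⟨c, t₀, hc, ht₀, h⟩
    exact ⟨c, t₀, hc, ht₀, fun x hx => h x ⟨hx.1, hST hx.2⟩⟩
  · rintro S T ⟨c, t₀, hc, ht₀, h⟩ ⟨c', t₀', hc', ht₀', h'⟩
    refine ⟨min c c', min t₀ t₀', lt_min hc hc', lt_min ht₀ ht₀', ?_⟩
    rintro x ⟨hxΩ, hx⟩ t ht htt
    rcases hx with hx | hx
    · obtain ⟨y, hy, hyΩ⟩ := h x ⟨hxΩ, hx⟩ t ht (htt.trans (min_le_left _ _))
      exact ⟨y, hy, (Metric.ball_subset_ball (by gcongr; exact min_le_left _ _)).trans hyΩ⟩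
    · obtain ⟨y, hy, hyΩ⟩ := h' x ⟨hxΩ, hx⟩ t ht (htt.trans (min_le_right _ _))
      exact ⟨y, hy, (Metric.ball_subset_ball (by gcongr; exact min_le_right _ _)).trans hyΩ⟩
  · intro x₀ hx₀
    by_cases hxΩ : x₀ ∈ Ω
    · obtain ⟨r, hr, hball⟩ := Metric.isOpen_iff.1 hΩo x₀ hxΩ
      refine ⟨Metric.ball x₀ (r / 2), mem_nhdsWithin_of_mem_nhds
        (Metric.ball_mem_nhds _ (by positivity)), 1, r / 2, one_pos, by positivity, ?_⟩
      rintro x ⟨-, hx⟩ t ht htr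
      refine ⟨x, by simpa using ht.le, fun z hz => hball ?_⟩
      rw [Metric.mem_ball] at *
      linarith [dist_triangle z x x₀]
    · obtain ⟨U, hU, h⟩ := exists_corkscrew_of_mem_frontier hΩ
        (x₀ := x₀) ⟨hx₀, fun h => hxΩ (interior_subset h)⟩
      exact ⟨U, mem_nhdsWithin_of_mem_nhds hU, h⟩

/-! ### Separated sets -/

/-- Rescale to the unit ball and cover it by finitely many balls of radius `c / 2`; each contains at
most one rescaled point. -/
theorem exists_card_le_of_separated (n : ℕ) {c : ℝ} (hc : 0 < c) :
    ∃ κ : ℕ, ∀ (J : Finset (E n)) (z : E n) (R : ℝ), 0 < R → (∀ y ∈ J, dist y z ≤ R) →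
      (∀ y ∈ J, ∀ y' ∈ J, y ≠ y' → c * R ≤ dist y y') → J.card ≤ κ := by
  obtain ⟨t, -, htf, htc⟩ := finite_cover_balls_of_compact
    (isCompact_closedBall (0 : E n) 1) (half_pos hc)
  refine ⟨htf.toFinset.card, fun J z R hR hJ hsep => ?_⟩
  have hnear : ∀ y ∈ J, ∃ p ∈ t, dist (R⁻¹ • (y - z)) p < c / 2 := by
    intro y hy
    have : R⁻¹ • (y - z) ∈ Metric.closedBall (0 : E n) 1 := by
      rw [mem_closedBall_zero_iff, norm_smul, norm_inv, Real.norm_of_nonneg hR.le,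
        ← dist_eq_norm, inv_mul_eq_div]
      exact (div_le_one hR).2 (hJ y hy)
    simpa using htc this
  choose! p hpt hp using hnear
  refine Finset.card_le_card_of_injOn p (fun y hy => ?_) fun y hy y' hy' hyy => ?_
  · simpa using hpt y hy
  · by_contra hne
    have h1 := hsep y hy y' hy' hne
    have h2 := dist_triangle_right (R⁻¹ • (y - z)) (R⁻¹ • (y' - z)) (p y)
    have h3 := hp y hy
    have h4 := hp y' hy'
    rw [← hyy] at h4
    have h5 : dist (R⁻¹ • (y - z)) (R⁻¹ • (y' - z)) = R⁻¹ * dist y y' := by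
      rw [dist_eq_norm, ← smul_sub, sub_sub_sub_cancel_right, norm_smul, norm_inv,
        Real.norm_of_nonneg hR.le, dist_eq_norm]
    have h6 : R⁻¹ * dist y y' < c := by linarith
    rw [inv_mul_lt_iff₀ hR] at h6
    linarith

theorem exists_finset_separated_cover {n : ℕ} {G : Set (E n)} (hG : Bornology.IsBounded G)
    {ρ : ℝ} (hρ : 0 < ρ) :
    ∃ N : Finset (E n), (↑N ⊆ G) ∧ (∀ y ∈ N, ∀ y' ∈ N, y ≠ y' → ρ ≤ dist y y') ∧
      ∀ x ∈ G, ∃ y ∈ N, dist x y < ρ := by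
  classical
  obtain ⟨R, hR, hGR⟩ := hG.subset_closedBall_lt 0 0
  obtain ⟨κ, hκ⟩ := exists_card_le_of_separated n (div_pos hρ hR)
  set S : Set ℕ := {k | ∃ J : Finset (E n), (↑J ⊆ G) ∧
    (∀ y ∈ J, ∀ y' ∈ J, y ≠ y' → ρ ≤ dist y y') ∧ J.card = k} with hS
  have hSne : S.Nonempty := ⟨0, ∅, by simp, by simp, rfl⟩
  have hSb : BddAbove S := by
    refine ⟨κ, ?_⟩
    rintro k ⟨J, hJG, hJ, rfl⟩
    exact hκ J 0 R hR (fun y hy => hGR (hJG hy)) (by rwa [div_mul_cancel₀ _ hR.ne'])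
  obtain ⟨N, hNG, hN, hcard⟩ := Nat.sSup_mem hSne hSb
  -- A separated set of largest cardinality covers: an uncovered point could be added to it.
  refine ⟨N, hNG, hN, fun x hx => ?_⟩
  by_contra! hcon
  have hxN : x ∉ N := fun h => by simpa using (hcon x h).trans_lt' hρ
  have : (insert x N).card ∈ S := by
    refine ⟨insert x N, ?_, ?_, rfl⟩
    · rw [Finset.coe_insert]
      exact Set.insert_subset hx hNG
    · intro y hy y' hy' hne
      rw [Finset.mem_insert] at hy hy'
      rcases hy with rfl | hy <;> rcases hy' with rfl | hy'
      · exact absurd rfl hne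
      · exact hcon _ hy'
      · rw [dist_comm]; exact hcon _ hy
      · exact hN _ hy _ hy' hne
  have h1 := le_csSup hSb this
  rw [Finset.card_insert_of_notMem hxN, hcard] at h1
  omega

/-! ### A measurable partition of unity attached to separated points -/

section Cells

variable {n : ℕ} {ι : Type*}

/-- The points within `R` of `y j` that are at distance at least `d` from the other `y i`. -/
def cell (y : ι → E n) (d R : ℝ) (j : ι) : Set (E n) :=
  {x | dist x (y j) < R ∧ ∀ i, i ≠ j → d ≤ dist x (y i)}

theorem indicator_cell_nonneg (y : ι → E n) (d R : ℝ) (j : ι) (x : E n) :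
    0 ≤ (cell y d R j).indicator (1 : E n → ℝ) x :=
  Set.indicator_nonneg (fun _ _ => zero_le_one) x

theorem mem_cell_of_dist_lt {y : ι → E n} {d R : ℝ} (hdR : d ≤ R)
    (hsep : ∀ i j, i ≠ j → 2 * d ≤ dist (y i) (y j)) {j : ι} {x : E n} (hx : dist x (y j) < d) :
    x ∈ cell y d R j := by
  refine ⟨hx.trans_le hdR, fun i hij => ?_⟩
  have h1 := hsep i j hij
  have h2 := dist_triangle_left (y i) (y j) x
  linarith

variable [Fintype ι]

/-- The indicator functions of the cells, normalized to have sum `1`. -/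
noncomputable def cellWeight (y : ι → E n) (d R : ℝ) (j : ι) (x : E n) : ℝ :=
  (cell y d R j).indicator 1 x / ∑ i, (cell y d R i).indicator (1 : E n → ℝ) x

theorem measurableSet_cell (y : ι → E n) (d R : ℝ) (j : ι) : MeasurableSet (cell y d R j) := by
  have : cell y d R j = {x | dist x (y j) < R} ∩ ⋂ i, ⋂ (_ : i ≠ j), {x | d ≤ dist x (y i)} := by
    ext x
    simp [cell]
  rw [this]
  exact (measurableSet_lt (by fun_prop) measurable_const).inter
    (MeasurableSet.iInter fun i => MeasurableSet.iInter fun _ =>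
      measurableSet_le measurable_const (by fun_prop))

theorem measurable_cellWeight (y : ι → E n) (d R : ℝ) (j : ι) :
    Measurable (cellWeight y d R j) :=
  (measurable_one.indicator (measurableSet_cell y d R j)).div
    (Finset.measurable_fun_sum _ fun i _ => measurable_one.indicator (measurableSet_cell y d R i))

theorem cellWeight_nonneg (y : ι → E n) (d R : ℝ) (j : ι) (x : E n) : 0 ≤ cellWeight y d R j x :=
  div_nonneg (indicator_cell_nonneg y d R j x)
    (Finset.sum_nonneg fun i _ => indicator_cell_nonneg y d R i x)

theorem cellWeight_le_one (y : ι → E n) (d R : ℝ) (j : ι) (x : E n) : cellWeight y d R j x ≤ 1 :=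
  div_le_one_of_le₀ (Finset.single_le_sum (f := fun i => (cell y d R i).indicator (1 : E n → ℝ) x)
    (fun i _ => indicator_cell_nonneg y d R i x) (Finset.mem_univ j))
    (Finset.sum_nonneg fun i _ => indicator_cell_nonneg y d R i x)

theorem cellWeight_eq_zero {y : ι → E n} {d R : ℝ} {j : ι} {x : E n} (hx : R ≤ dist x (y j)) :
    cellWeight y d R j x = 0 := by
  rw [cellWeight, Set.indicator_of_notMem (fun h => not_lt.2 hx h.1), zero_div]

theorem cellWeight_eq_one {y : ι → E n} {d R : ℝ} (hdR : d ≤ R)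
    (hsep : ∀ i j, i ≠ j → 2 * d ≤ dist (y i) (y j)) {j : ι} {x : E n} (hx : dist x (y j) < d) :
    cellWeight y d R j x = 1 := by
  have hxj := mem_cell_of_dist_lt hdR hsep hx
  rw [cellWeight, Finset.sum_eq_single j, Set.indicator_of_mem hxj]
  · simp
  · intro i _ hij
    exact Set.indicator_of_notMem (fun h => not_le.2 hx (h.2 j hij.symm)) _
  · simp

/-- The cells cover every point within `R` of a centre: a point closer than `d` to some centre lies
in that cell by separation, and any other point lies in the cell of each centre within `R`. -/
theorem sum_cellWeight {y : ι → E n} {d R : ℝ} (hdR : d ≤ R)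
    (hsep : ∀ i j, i ≠ j → 2 * d ≤ dist (y i) (y j)) {x : E n} (hx : ∃ j, dist x (y j) < R) :
    ∑ j, cellWeight y d R j x = 1 := by
  have hex : ∃ j, x ∈ cell y d R j := by
    by_cases h : ∃ j, dist x (y j) < d
    · obtain ⟨j, hj⟩ := h
      exact ⟨j, mem_cell_of_dist_lt hdR hsep hj⟩
    · push Not at h
      obtain ⟨j, hj⟩ := hx
      exact ⟨j, hj, fun i _ => h i⟩
  obtain ⟨j, hj⟩ := hex
  unfold cellWeight
  rw [← Finset.sum_div]
  refine div_self (ne_of_gt ?_)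
  refine lt_of_lt_of_le (b := (cell y d R j).indicator (1 : E n → ℝ) x) ?_
    (Finset.single_le_sum (f := fun i => (cell y d R i).indicator (1 : E n → ℝ) x)
      (fun i _ => indicator_cell_nonneg y d R i x) (Finset.mem_univ j))
  rw [Set.indicator_of_mem hj]
  exact one_pos

end Cells

/-! ### Convolution with a rescaled bump -/

open scoped Convolution

theorem hasCompactSupport_iteratedFDeriv_apply {n : ℕ} {g : E n → ℝ} (hg : HasCompactSupport g)
    (l : ℕ) (v : Fin l → E n) : HasCompactSupport fun z => iteratedFDeriv ℝ l g z v :=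
  HasCompactSupport.comp_left (hg.iteratedFDeriv (𝕜 := ℝ) l)
    (g := fun T : ContinuousMultilinearMap ℝ (fun _ : Fin l => E n) ℝ => T v) rfl

theorem iteratedFDeriv_convolution_apply {n : ℕ} {u g : E n → ℝ}
    (hu : LocallyIntegrable u (volume : Measure (E n))) (hgc : HasCompactSupport g)
    (hg : ContDiff ℝ (⊤ : ℕ∞) g) (l : ℕ) (v : Fin l → E n) (x : E n) :
    iteratedFDeriv ℝ l (u ⋆[ContinuousLinearMap.lsmul ℝ ℝ] g) x v =
      (u ⋆[ContinuousLinearMap.lsmul ℝ ℝ] fun z => iteratedFDeriv ℝ l g z v) x := by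
  induction l generalizing x with
  | zero => simp
  | succ l ih =>
    have hconv : ContDiff ℝ (⊤ : ℕ∞) (u ⋆[ContinuousLinearMap.lsmul ℝ ℝ] g) :=
      hgc.contDiff_convolution_right _ hu hg
    have hdiff : ∀ {F : E n → ℝ}, ContDiff ℝ (⊤ : ℕ∞) F →
        Differentiable ℝ (iteratedFDeriv ℝ l F) := fun hF =>
      hF.differentiable_iteratedFDeriv (by exact_mod_cast ENat.natCast_lt_top l)
    have hgl : ContDiff ℝ 1 fun z => iteratedFDeriv ℝ l g z (Fin.tail v) := by
      have : ContDiff ℝ 1 (iteratedFDeriv ℝ l g) :=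
        hg.iteratedFDeriv_right (by exact_mod_cast le_top)
      exact (ContinuousMultilinearMap.apply ℝ (fun _ : Fin l => E n) ℝ (Fin.tail v)).contDiff.comp this
    have hglc : HasCompactSupport fun z => iteratedFDeriv ℝ l g z (Fin.tail v) :=
      hasCompactSupport_iteratedFDeriv_apply hgc l _
    rw [DifferentiableAt.iteratedFDeriv_succ_apply_left' ((hdiff hconv) x)]
    rw [funext fun z => ih (Fin.tail v) z]
    rw [(hglc.hasFDerivAt_convolution_right _ hu hgl x).fderiv,
      convolution_precompR_apply _ hu (hglc.fderiv ℝ) (hgl.continuous_fderiv one_ne_zero)]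
    congr 1
    ext z
    rw [DifferentiableAt.iteratedFDeriv_succ_apply_left' ((hdiff hg) z)]

theorem abs_convolution_le {n : ℕ} {u G : E n → ℝ} (hu1 : ∀ x, |u x| ≤ 1)
    (hG : Integrable G) (x : E n) :
    |(u ⋆[ContinuousLinearMap.lsmul ℝ ℝ] G) x| ≤ ∫ z, |G z| := by
  rw [convolution_def, ← Real.norm_eq_abs, ← integral_sub_left_eq_self (fun z => |G z|) volume x]
  refine norm_integral_le_of_norm_le (hG.abs.comp_sub_left x) (Filter.Eventually.of_forall fun z => ?_)
  simp only [ContinuousLinearMap.lsmul_apply, smul_eq_mul, norm_mul, Real.norm_eq_abs]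
  exact mul_le_of_le_one_left (abs_nonneg _) (hu1 z)

/-- The rescaled kernel `δ⁻ⁿ g(x / δ)`. -/
noncomputable def rescaleReal {n : ℕ} (δ : ℝ) (g : E n → ℝ) : E n → ℝ :=
  fun z => (δ ^ n)⁻¹ * g (δ⁻¹ • z)

theorem iteratedFDeriv_rescaleReal {n : ℕ} (δ : ℝ) {g : E n → ℝ} (hg : ContDiff ℝ (⊤ : ℕ∞) g)
    (l : ℕ) (v : Fin l → E n) (z : E n) :
    iteratedFDeriv ℝ l (rescaleReal δ g) z v =
      δ⁻¹ ^ l * ((δ ^ n)⁻¹ * iteratedFDeriv ℝ l g (δ⁻¹ • z) v) := by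
  have h1 : rescaleReal δ g = (δ ^ n)⁻¹ • (g ∘ (δ⁻¹ • ContinuousLinearMap.id ℝ (E n))) := by
    ext z
    simp [rescaleReal]
  have h2 : ContDiff ℝ l (g ∘ (δ⁻¹ • ContinuousLinearMap.id ℝ (E n))) :=
    (hg.of_le (by exact_mod_cast le_top)).comp (ContinuousLinearMap.contDiff _)
  rw [h1, iteratedFDeriv_const_smul_apply h2.contDiffAt,
    ContinuousLinearMap.iteratedFDeriv_comp_right _ hg _ (by exact_mod_cast le_top)]
  simp only [smul_apply, ContinuousMultilinearMap.compContinuousLinearMap_apply,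
    ContinuousLinearMap.id_apply, smul_eq_mul]
  rw [ContinuousMultilinearMap.map_smul_univ]
  simp only [Finset.prod_const, Finset.card_univ, Fintype.card_fin, smul_eq_mul]
  ring

theorem integral_rescaleReal {n : ℕ} {δ : ℝ} (hδ : 0 < δ) (G : E n → ℝ) :
    ∫ z, rescaleReal δ G z = ∫ z, G z := by
  have := integral_comp_affine (inv_pos.2 hδ) 0 G
  simp only [add_zero, smul_eq_mul, inv_pow, inv_inv] at this
  simp only [rescaleReal]
  rw [integral_const_mul, this, inv_mul_cancel_left₀ (pow_pos hδ n).ne']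

/-- All derivatives fall on the kernel, each costing `δ⁻¹`; of `u` only `|u| ≤ 1` matters. -/
theorem abs_iteratedFDeriv_mollify_le {n : ℕ} {u g : E n → ℝ} (hum : Measurable u)
    (hu1 : ∀ x, |u x| ≤ 1) (hgc : HasCompactSupport g) (hg : ContDiff ℝ (⊤ : ℕ∞) g)
    {δ : ℝ} (hδ : 0 < δ) (l : ℕ) (v : Fin l → E n) (x : E n) :
    |iteratedFDeriv ℝ l (u ⋆[ContinuousLinearMap.lsmul ℝ ℝ] rescaleReal δ g) x v| ≤
      δ⁻¹ ^ l * ∫ z, |iteratedFDeriv ℝ l g z v| := by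
  have hgδ : ContDiff ℝ (⊤ : ℕ∞) (rescaleReal δ g) :=
    contDiff_const.mul (hg.comp (contDiff_const_smul _))
  have hgδc : HasCompactSupport (rescaleReal δ g) :=
    HasCompactSupport.mul_left (hgc.comp_smul (inv_pos.2 hδ).ne')
  have hu : LocallyIntegrable u (volume : Measure (E n)) :=
    (locallyIntegrable_const (1 : ℝ)).mono hum.aestronglyMeasurable
      (Filter.Eventually.of_forall fun x => by simpa using hu1 x)
  rw [iteratedFDeriv_convolution_apply hu hgδc hgδ]
  have hcont : Continuous fun z => iteratedFDeriv ℝ l (rescaleReal δ g) z v :=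
    (ContinuousMultilinearMap.apply ℝ (fun _ : Fin l => E n) ℝ v).continuous.comp
      (hgδ.continuous_iteratedFDeriv (by exact_mod_cast le_top))
  have hcs : HasCompactSupport fun z => iteratedFDeriv ℝ l (rescaleReal δ g) z v :=
    hasCompactSupport_iteratedFDeriv_apply hgδc l v
  refine (abs_convolution_le hu1 (hcont.integrable_of_hasCompactSupport hcs) x).trans (le_of_eq ?_)
  rw [← integral_rescaleReal hδ fun z => |iteratedFDeriv ℝ l g z v|, ← integral_const_mul]
  congr 1
  ext z
  rw [iteratedFDeriv_rescaleReal δ hg, rescaleReal, abs_mul, abs_mul,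
    abs_of_pos (pow_pos (inv_pos.2 hδ) l), abs_of_pos (inv_pos.2 (pow_pos hδ n))]

open scoped Convolution

/-- A mollifier: smooth, nonnegative, vanishing outside the unit ball, with integral `1`. -/
structure IsMollifier {n : ℕ} (g : E n → ℝ) : Prop where
  contDiff : ContDiff ℝ (⊤ : ℕ∞) g
  nonneg : ∀ z, 0 ≤ g z
  eq_zero : ∀ z, 1 ≤ ‖z‖ → g z = 0
  integral_eq_one : ∫ z, g z = 1

theorem exists_isMollifier (n : ℕ) : ∃ g : E n → ℝ, IsMollifier g := by
  let b : ContDiffBump (0 : E n) := ⟨1 / 2, 1, by norm_num, by norm_num⟩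
  refine ⟨b.normed volume, b.contDiff_normed, b.nonneg_normed, fun z hz => ?_, b.integral_normed⟩
  have : z ∉ Function.support (b.normed volume) := by
    rw [b.support_normed_eq]
    simpa [b] using hz
  simpa using this

section Mollify

variable {n : ℕ} {g : E n → ℝ}

theorem IsMollifier.hasCompactSupport (hg : IsMollifier g) : HasCompactSupport g :=
  HasCompactSupport.intro (isCompact_closedBall (0 : E n) 1) fun z hz =>
    hg.eq_zero z (by simpa using (not_le.1 (by simpa using hz)).le)

theorem IsMollifier.rescaleReal_eq_zero (hg : IsMollifier g) {δ : ℝ} (hδ : 0 < δ) {z : E n}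
    (hz : δ ≤ ‖z‖) : rescaleReal δ g z = 0 := by
  rw [rescaleReal, hg.eq_zero, mul_zero]
  rw [norm_smul, norm_inv, Real.norm_of_nonneg hδ.le, inv_mul_eq_div]
  exact (one_le_div hδ).2 hz

theorem IsMollifier.rescaleReal_nonneg (hg : IsMollifier g) {δ : ℝ} (hδ : 0 < δ) (z : E n) :
    0 ≤ rescaleReal δ g z :=
  mul_nonneg (inv_pos.2 (pow_pos hδ n)).le (hg.nonneg _)

theorem IsMollifier.rescaleReal_contDiff (hg : IsMollifier g) (δ : ℝ) :
    ContDiff ℝ (⊤ : ℕ∞) (rescaleReal δ g) :=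
  contDiff_const.mul (hg.contDiff.comp (contDiff_const_smul _))

theorem IsMollifier.rescaleReal_hasCompactSupport (hg : IsMollifier g) {δ : ℝ} (hδ : 0 < δ) :
    HasCompactSupport (rescaleReal δ g) :=
  HasCompactSupport.mul_left (hg.hasCompactSupport.comp_smul (inv_pos.2 hδ).ne')

/-- The convolution of `u` with `δ⁻ⁿ g(x / δ)`. -/
noncomputable def mollify (δ : ℝ) (g u : E n → ℝ) : E n → ℝ :=
  u ⋆[ContinuousLinearMap.lsmul ℝ ℝ] rescaleReal δ g

theorem mollify_apply (δ : ℝ) (g u : E n → ℝ) (x : E n) :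
    mollify δ g u x = ∫ z, u z * rescaleReal δ g (x - z) := rfl

variable {u : E n → ℝ}

theorem IsMollifier.integral_rescaleReal_sub (hg : IsMollifier g) {δ : ℝ} (hδ : 0 < δ) (x : E n) :
    ∫ z, rescaleReal δ g (x - z) = 1 := by
  rw [integral_sub_left_eq_self (rescaleReal δ g) volume x, integral_rescaleReal hδ,
    hg.integral_eq_one]

theorem IsMollifier.mollify_nonneg (hg : IsMollifier g) {δ : ℝ} (hδ : 0 < δ) (hu : ∀ x, 0 ≤ u x)
    (x : E n) : 0 ≤ mollify δ g u x :=
  integral_nonneg fun z => mul_nonneg (hu z) (hg.rescaleReal_nonneg hδ _)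

theorem IsMollifier.mollify_eq_const (hg : IsMollifier g) {δ : ℝ} (hδ : 0 < δ) {x : E n} {a : ℝ}
    (hu : ∀ z, dist z x < δ → u z = a) : mollify δ g u x = a := by
  rw [mollify_apply]
  have : ∀ z, u z * rescaleReal δ g (x - z) = a * rescaleReal δ g (x - z) := by
    intro z
    by_cases hz : dist z x < δ
    · rw [hu z hz]
    · rw [hg.rescaleReal_eq_zero hδ, mul_zero, mul_zero]
      rw [← dist_eq_norm, dist_comm]
      exact not_lt.1 hz
  simp_rw [this]
  rw [integral_const_mul, hg.integral_rescaleReal_sub hδ, mul_one]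

theorem locallyIntegrable_of_abs_le_one (hum : Measurable u) (hu1 : ∀ x, |u x| ≤ 1) :
    LocallyIntegrable u (volume : Measure (E n)) :=
  (locallyIntegrable_const (1 : ℝ)).mono hum.aestronglyMeasurable
    (Filter.Eventually.of_forall fun x => by simpa using hu1 x)

theorem IsMollifier.mollify_contDiff (hg : IsMollifier g) {δ : ℝ} (hδ : 0 < δ)
    (hu : LocallyIntegrable u (volume : Measure (E n))) :
    ContDiff ℝ (⊤ : ℕ∞) (mollify δ g u) :=
  (hg.rescaleReal_hasCompactSupport hδ).contDiff_convolution_right _ hu (hg.rescaleReal_contDiff δ)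

theorem IsMollifier.sum_mollify (hg : IsMollifier g) {δ : ℝ} (hδ : 0 < δ) {ι : Type*}
    (J : Finset ι) {v : ι → E n → ℝ} (hv : ∀ j, LocallyIntegrable (v j) (volume : Measure (E n)))
    (x : E n) : ∑ j ∈ J, mollify δ g (v j) x = mollify δ g (fun z => ∑ j ∈ J, v j z) x := by
  simp only [mollify_apply, Finset.sum_mul]
  rw [integral_finsetSum]
  intro j _
  exact (hg.rescaleReal_hasCompactSupport hδ).convolutionExists_right
    (ContinuousLinearMap.lsmul ℝ ℝ) (hv j) (hg.rescaleReal_contDiff δ).continuous x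

end Mollify

end GFEM

/-! ### Choice of scales and verification of the assumptions -/

theorem mainTheorem9 (n : ℕ) (hn : 1 ≤ n) (Ω : Set (GFEM.E n)) (hΩ : IsOpen Ω)
    (hΩb : Bornology.IsBounded Ω) (hΩc : GFEM.HasPiecewiseC1Boundary Ω)
    (m k : ℕ) (hk : 1 ≤ k) :
    ∃ (A B : ℝ) (C : ℕ → ℝ) (κ : ℕ) (σ : ℝ),
      0 < A ∧ 0 < B ∧ (∀ l, 0 < C l) ∧ 0 < σ ∧
      ∃ h₀ : ℝ, 0 < h₀ ∧ ∀ h : ℝ, 0 < h → h < h₀ →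
        ∃ (ι : Type) (ω : ι → Set (GFEM.E n)) (c : ι → GFEM.E n) (r : ι → ℝ)
          (φ : ι → GFEM.E n → ℝ),
          GFEM.AssumptionA Ω σ h ω c r φ ∧
          GFEM.AssumptionB Ω κ m C ω c r φ ∧
          GFEM.AssumptionC A m ω c r (fun _ => GFEM.polySpace n k) ∧
          GFEM.AssumptionD B m ω (fun _ => GFEM.polySpace n k) := by
  open GFEM in
  obtain ⟨c₀, t₀, hc₀, ht₀, hcork⟩ := exists_corkscrew hΩ hΩb hΩc
  obtain ⟨c, hc, hc1, hcc⟩ : ∃ c : ℝ, 0 < c ∧ c ≤ 1 ∧ c ≤ c₀ :=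
    ⟨min c₀ 1, lt_min hc₀ one_pos, min_le_right _ _, min_le_left _ _⟩
  obtain ⟨g, hg⟩ := exists_isMollifier n
  obtain ⟨A, hA, hAle⟩ := sobolevNorm_ball_le n k (a := c / 64) (by positivity) (by linarith)
  obtain ⟨B, hB, hBle⟩ := sobolevNorm_inverse_ball n k m
  -- At radius `h / 2` the ratio `c / 8` is exactly the separation `ρ = c * h / 16`.
  obtain ⟨κ, hκ⟩ := exists_card_le_of_separated n (c := c / 8) (by positivity)
  let I : ∀ l : ℕ, (Fin l → Fin n) → ℝ := fun l a =>
    ∫ z, |iteratedFDeriv ℝ l g z fun i => EuclideanSpace.single (a i) (1 : ℝ)|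
  have hI : ∀ l a, 0 ≤ I l a := fun l a => integral_nonneg fun z => abs_nonneg _
  refine ⟨A, B, fun l => 1 + ∑ a, (128 / c) ^ l * I l a, κ, c / 64, hA, hB, fun l => ?_,
    by positivity, min 1 t₀, lt_min one_pos ht₀, fun h hh hh0 => ?_⟩
  · exact lt_of_lt_of_le one_pos (le_add_of_nonneg_right
      (Finset.sum_nonneg fun a _ => mul_nonneg (by positivity) (hI l a)))
  have hh1 : h ≤ 1 := (hh0.trans_le (min_le_left _ _)).le
  have hht : h ≤ t₀ := (hh0.trans_le (min_le_right _ _)).le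
  obtain ⟨ρ, hρ⟩ : ∃ ρ : ℝ, ρ = c * (h / 16) := ⟨_, rfl⟩
  have hρ0 : 0 < ρ := by rw [hρ]; positivity
  have hρh : ρ ≤ h / 16 := by rw [hρ]; exact mul_le_of_le_one_left (by positivity) hc1
  set G : Set (E n) := {y | Metric.ball y ρ ⊆ Ω} with hG
  have hGb : Bornology.IsBounded G :=
    hΩb.subset fun y hy => hy (Metric.mem_ball_self hρ0)
  obtain ⟨N, hNG, hNsep, hNcov⟩ := exists_finset_separated_cover hGb hρ0
  let y : N → E n := Subtype.val
  -- Mollification will use `δ = ρ / 8`. The inner radius `ρ / 4 = 2 * δ` leaves weight `1` on the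
  -- `δ`-ball; the outer radius `3h / 16` exceeds `h / 8 + δ`, so the sum stays `1` on `Ω`, and
  -- adding `δ` keeps supports within `h / 4`.
  let u : N → E n → ℝ := cellWeight y (ρ / 4) (3 * (h / 16))
  have hsep : ∀ i j, i ≠ j → ρ ≤ dist (y i) (y j) := fun i j hij =>
    hNsep _ i.2 _ j.2 (fun h => hij (Subtype.ext h))
  have hsep' : ∀ i j, i ≠ j → 2 * (ρ / 4) ≤ dist (y i) (y j) := fun i j hij => by
    linarith [hsep i j hij]
  have hcov : ∀ x ∈ Ω, ∃ j, dist x (y j) < h / 8 := by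
    intro x hx
    obtain ⟨z, hzx, hz⟩ := hcork x hx (h / 16) (by positivity) (by linarith)
    have hzG : z ∈ G := (Metric.ball_subset_ball (by rw [hρ]; gcongr)).trans hz
    obtain ⟨p, hpN, hp⟩ := hNcov z hzG
    refine ⟨⟨p, hpN⟩, ?_⟩
    have := dist_triangle_left x p z
    change dist x p < _
    linarith
  obtain ⟨δ, hδ⟩ : ∃ δ : ℝ, δ = ρ / 8 := ⟨_, rfl⟩
  have hδ0 : 0 < δ := by rw [hδ]; positivity
  have hδh : 2 * δ = c / 64 * h := by rw [hδ, hρ]; ring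
  have hδinv : δ⁻¹ = 128 / c / h := by rw [hδ, hρ]; field_simp; norm_num
  have hum : ∀ j, Measurable (u j) := fun j => measurable_cellWeight _ _ _ j
  have hu0 : ∀ j x, 0 ≤ u j x := fun j x => cellWeight_nonneg _ _ _ j x
  have hu1 : ∀ j x, |u j x| ≤ 1 := fun j x => by
    rw [abs_of_nonneg (hu0 j x)]
    exact cellWeight_le_one _ _ _ j x
  have huL : ∀ j, LocallyIntegrable (u j) (volume : Measure (E n)) := fun j =>
    locallyIntegrable_of_abs_le_one (hum j) (hu1 j)
  have hsmooth : ∀ j, ContDiff ℝ (⊤ : ℕ∞) (mollify δ g (u j)) := fun j =>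
    hg.mollify_contDiff hδ0 (huL j)
  have hsupp : ∀ j, tsupport (mollify δ g (u j)) ⊆ Metric.closedBall (y j) (h / 4) := by
    intro j
    refine closure_minimal (fun x hx => ?_) Metric.isClosed_closedBall
    by_contra hxb
    rw [Metric.mem_closedBall, not_le] at hxb
    refine hx (hg.mollify_eq_const hδ0 fun z hz => cellWeight_eq_zero ?_)
    have := dist_triangle_left x (y j) z
    linarith
  -- In dimension `0` balls would have diameter `0` instead of `h`.
  have : Nonempty (Fin n) := ⟨⟨0, hn⟩⟩
  have hdiam : ∀ j : N, Metric.diam (Metric.ball (y j) (h / 2)) = h := fun j => by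
    rw [Metric.diam_ball_eq _ (by positivity)]
    ring
  refine ⟨N, fun j => Metric.ball (y j) (h / 2), y, fun _ => δ, fun j => mollify δ g (u j),
    ⟨hh1, fun j => convex_ball _ _, fun j => Metric.isBounded_ball, fun j => (hdiam j).le,
      fun j => hδh.ge, fun j => ?_, fun j _ => ?_⟩, ⟨⟨fun j => Metric.isOpen_ball, ?_, ?_,
      fun j => hg.mollify_nonneg hδ0 (hu0 j), ?_, fun j => ?_, fun j => ?_,
      fun j => (hsmooth j).of_le (by exact_mod_cast le_top), ?_⟩, ?_⟩, ⟨?_, ?_, ?_⟩, ?_⟩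
  · exact Metric.closure_ball_subset_closedBall.trans
      (Metric.closedBall_subset_ball (by linarith))
  · exact (Metric.ball_subset_ball (by linarith)).trans (hNG j.2)
  · intro x hx
    obtain ⟨j, hj⟩ := hcov x hx
    exact Set.mem_iUnion.2 ⟨j, Metric.mem_ball.2 (by linarith)⟩
  · rintro J hJ ⟨z, hz⟩
    have := hκ (J.map ⟨y, Subtype.val_injective⟩) z (h / 2) (by positivity) ?_ ?_
    · rw [Finset.card_map, hJ] at this
      omega
    · intro p hp
      obtain ⟨j, hj, rfl⟩ := Finset.mem_map.1 hp
      rw [dist_comm]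
      exact (Metric.mem_ball.1 (Set.mem_iInter₂.1 hz j hj)).le
    · intro p hp q hq hpq
      obtain ⟨i, hi, rfl⟩ := Finset.mem_map.1 hp
      obtain ⟨j, hj, rfl⟩ := Finset.mem_map.1 hq
      refine le_trans (le_of_eq ?_) (hsep i j fun hij => hpq (by rw [hij]))
      rw [hρ]
      ring
  · intro x hx
    rw [finsum_eq_sum_of_fintype, hg.sum_mollify hδ0 _ huL]
    refine hg.mollify_eq_const hδ0 fun z hz => sum_cellWeight (by linarith) hsep' ?_
    obtain ⟨j, hj⟩ := hcov x hx
    refine ⟨j, ?_⟩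
    have := dist_triangle z x (y j)
    linarith
  · exact ContDiff.lipschitzWith_of_hasCompactSupport
      ((isCompact_closedBall _ _).of_isClosed_subset (isClosed_tsupport _) (hsupp j)) (hsmooth j) (by simp)
  · exact (hsupp j).trans (Metric.closedBall_subset_ball (by linarith))
  · intro j l _ a x _
    rw [hdiam j]
    refine (abs_iteratedFDeriv_mollify_le (hum j) (hu1 j) hg.hasCompactSupport hg.contDiff hδ0 l
      _ x).trans ?_
    rw [hδinv, div_pow, div_mul_eq_mul_div]
    refine div_le_div_of_nonneg_right ?_ (by positivity)
    have := Finset.single_le_sum (f := fun a => (128 / c) ^ l * I l a)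
      (fun a _ => mul_nonneg (by positivity) (hI l a)) (Finset.mem_univ a)
    exact this.trans (le_add_of_nonneg_left zero_le_one)
  · intro j x hx
    rw [Metric.mem_ball] at hx
    refine hg.mollify_eq_const hδ0 fun z hz => cellWeight_eq_one (by linarith) hsep' ?_
    have := dist_triangle z x (y j)
    linarith
  · intro j w hw
    exact sobolevNorm_ball_lt_top hw _ hh hh1
  · intro j p hp
    exact ⟨p, polySpace_mono hk hp, fun x _ => rfl⟩
  · intro j w hw l hl _
    have e : δ = c / 64 * (h / 2) := by linarith
    rw [e]
    exact hAle _ _ (by positivity) w hw l hl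
  · intro j w hw s t hs hst htm
    rw [hdiam j]
    exact hBle _ h hh hh1 w hw s t hs hst htm
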